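/- Let $\mathbb{F}$ be a field. A \emph{factored chain complex} is a functor $X$ from the poset $[0,\infty)$ to non-negatively graded chain complexes over $\mathbb{F}$ of finite total dimension such that all internal maps $X^{q\le r}$ are degreewise surjective and $X$ is tame: for every $t\ge 0$ there is $\varepsilon>0$ such that $X^{t\le t+\delta}$ is an isomorphism for all $0\le\delta\le\varepsilon$, and for all but finitely many $t>0$ there is $0<\varepsilon\le t$ such that $X^{t-\delta\le t}$ is an isomorphism for all $0\le\delta\le\varepsilon$. For $n\in\mathbb{N}=\{0,1,2,\dots\}$ and a tagged interval $[0,s,t)$ with $0<t\le\infty$ and $0\le s\le t$ (where $s=0$ is required if $n=0$), the interval functor $\mathcal{I}^n[0,s,t)$ is $\mathbb{F}$ in degree $n$ at parameters $r<t$, is $\mathbb{F}$ in degree $n-1$ at parameters $r<s$, and is $0$ otherwise; all differentials and internal maps between two copies of $\mathbb{F}$ are the identity. A \emph{tagged barcode} of $X$ is a sequence $(\mathrm{tBarc}_n(X))_{n\in\mathbb{N}}$ of finite multisets of tagged intervals with only finitely many non-empty terms (all tagged intervals in $\mathrm{tBarc}_0(X)$ having $s=0$) such that $$X\cong\bigoplus_{n\in\mathbb{N}}\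 \bigoplus_{[0,s,t)\in \mathrm{tBarc}_n(X)}\mathcal{I}^n[0,s,t).$$ For $\varepsilon>0$, an $\varepsilon$-interleaving of $X$ and $Y$ is a pair of natural transformations $\phi^r\colon X^r\to Y^{r+\varepsilon}$, $\psi^r\colon Y^r\to X^{r+\varepsilon}$ with $\psi^{r+\varepsilon}\circ\phi^r=X^{r\le r+2\varepsilon}$ and $\phi^{r+\varepsilon}\circ\psi^r=Y^{r\le r+2\varepsilon}$ for all $r\ge0$; the interleaving distance $d_I(X,Y)\in[0,\infty]$ is the infimum of the $\varepsilon>0$ for which one exists ($\inf\emptyset=\infty$). The bottleneck distance $d_B(\mathcal{A},\mathcal{B})\in[0,\infty]$ of finite multisets of tagged intervals is the infimum, over all partial matchings between $\mathcal{A}$ and $\mathcal{B}$ (elements counted with multiplicity), of the maximum of the costs $\max\{|s-s'|,|t-t'|\}$ of the matched pairs $([0,s,t),[0,s',t'))$ and the weights $t/2$ of the unmatched $[0,s,t)$ in $\mathcal{A}$ and $\mathcal{B}$, where $|\infty-\infty|=0$ and the maximum of the empty set is $0$. \textbf{Theorem (Isometry Theorem in $\mathbf{TEPCh}$).} Let $X$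 and $Y$ be factored chain complexes over $\mathbb{F}$. Then $X$ and $Y$ each have exactly one tagged barcode, and $$d_I(X,Y)=\max_{n\in\mathbb{N}} d_B\bigl(\mathrm{tBarc}_n(X),\mathrm{tBarc}_n(Y)\bigr),$$ where the maximum is attained. -/

import Mathlib

open CategoryTheory CategoryTheory.Limits
open scoped NNReal ENNReal

noncomputable section

namespace FactoredChain

/-! ### Parametrized objects -/

section ParametrizedObjects

universe v w

variable {C : Type w} [Category.{v} C]

/-- `X` is left-constant at `t`: either `t = 0`, or all internal maps into `X^t` from parameters
close enough below `t` are isomorphisms. -/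
def LeftConstantAt (X : ℝ≥0 ⥤ C) (t : ℝ≥0) : Prop :=
  t = 0 ∨ ∃ ε : ℝ≥0, 0 < ε ∧ ε ≤ t ∧
    ∀ δ : ℝ≥0, δ ≤ ε → IsIso (X.map (homOfLE (tsub_le_self : t - δ ≤ t)))

/-- `X` is right-constant at `t`: all internal maps from `X^t` to parameters close enough above
`t` are isomorphisms. -/
def RightConstantAt (X : ℝ≥0 ⥤ C) (t : ℝ≥0) : Prop :=
  ∃ ε : ℝ≥0, 0 < ε ∧
    ∀ δ : ℝ≥0, δ ≤ ε → IsIso (X.map (homOfLE (le_self_add : t ≤ t + δ)))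

/-- Tame parametrized objects. -/
def Tame (X : ℝ≥0 ⥤ C) : Prop :=
  (∀ t, RightConstantAt X t) ∧ {t | ¬ LeftConstantAt X t}.Finite

/-- Epimorphic parametrized objects: all internal maps are epimorphisms. -/
def Epimorphic (X : ℝ≥0 ⥤ C) : Prop :=
  ∀ (s t : ℝ≥0) (h : s ≤ t), Epi (X.map (homOfLE h))

/-- Translation of the parameter, `t ↦ t + ε`, as a functor. -/
def translate (ε : ℝ≥0) : ℝ≥0 ⥤ ℝ≥0 :=
  Monotone.functor (f := fun t : ℝ≥0 => t + ε) (fun _ _ h => add_le_add_left h ε)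

/-- The `ε`-shift `X_ε`, with `(X_ε)^t = X^{t + ε}`. -/
def shift (ε : ℝ≥0) (X : ℝ≥0 ⥤ C) : ℝ≥0 ⥤ C := translate ε ⋙ X

/-- `φ : X ⟶ Y_ε` and `ψ : Y ⟶ X_ε` form an `ε`-interleaving: `ψ_ε ∘ φ` and `φ_ε ∘ ψ` are given
by the internal maps of `X` and of `Y` of length `2ε` (written `ε + ε`). -/
def IsInterleaving (ε : ℝ≥0) {X Y : ℝ≥0 ⥤ C} (φ : X ⟶ shift ε Y) (ψ : Y ⟶ shift ε X) : Prop :=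
  (∀ t : ℝ≥0, φ.app t ≫ ψ.app (t + ε) =
      X.map (homOfLE (le_add_right le_self_add : t ≤ t + ε + ε))) ∧
  (∀ t : ℝ≥0, ψ.app t ≫ φ.app (t + ε) =
      Y.map (homOfLE (le_add_right le_self_add : t ≤ t + ε + ε)))

/-- `X` and `Y` are `ε`-interleaved. -/
def Interleaved (ε : ℝ≥0) (X Y : ℝ≥0 ⥤ C) : Prop :=
  ∃ (φ : X ⟶ shift ε Y) (ψ : Y ⟶ shift ε X), IsInterleaving ε φ ψ

/-- The interleaving distance, an element of `[0, ∞]` (with `inf ∅ = ∞`). -/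
def interleavingDist (X Y : ℝ≥0 ⥤ C) : ℝ≥0∞ :=
  ⨅ (ε : ℝ≥0) (_ : 0 < ε) (_ : Interleaved ε X Y), (ε : ℝ≥0∞)

end ParametrizedObjects

/-! ### The bottleneck distance between finite multisets -/

section Bottleneck

universe w

variable {S : Type w}

open scoped Classical in
/-- A set of pairs of elements of the multisets `A` and `B` (elements being counted with their
multiplicity, through `Multiset.ToType`) is a matching if every element of `A` and every element
of `B` occurs in at most one pair. -/
def IsMatching {A B : Multiset S} (M : Set (A.ToType × B.ToType)) : Prop :=
  (∀ (I : A.ToType) (J J' : B.ToType), (I, J) ∈ M → (I, J') ∈ M → J = J') ∧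
  (∀ (I I' : A.ToType) (J : B.ToType), (I, J) ∈ M → (I', J) ∈ M → I = I')

open scoped Classical in
/-- The cost of a matching with respect to a cost function `c` and a weight function `W`: the
maximum of the supremum of the costs of the matched pairs and the supremum of the weights of the
unmatched elements of `A` and of `B`. -/
def matchingCost (c : S → S → ℝ≥0∞) (W : S → ℝ≥0∞) {A B : Multiset S}
    (M : Set (A.ToType × B.ToType)) : ℝ≥0∞ :=
  (⨆ (I : A.ToType) (J : B.ToType) (_ : (I, J) ∈ M), c I.1 J.1) ⊔
    ((⨆ (I : A.ToType) (_ : ∀ J, (I, J) ∉ M), W I.1) ⊔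
      (⨆ (J : B.ToType) (_ : ∀ I, (I, J) ∉ M), W J.1))

open scoped Classical in
/-- The bottleneck distance defined by `c` and `W`: the infimum of the costs of all matchings. -/
def bottleneckDistOf (c : S → S → ℝ≥0∞) (W : S → ℝ≥0∞) (A B : Multiset S) : ℝ≥0∞ :=
  ⨅ (M : Set (A.ToType × B.ToType)) (_ : IsMatching M), matchingCost c W M

end Bottleneck

/-! ### Tagged intervals -/

/-- A tagged interval `[0, s, t)`: here `t = right`, `s = tag`, with `0 < t ≤ ∞` and
`0 ≤ s ≤ t`. -/
@[ext]
structure TaggedInterval where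
  tag : ℝ≥0∞
  right : ℝ≥0∞
  right_pos : 0 < right
  tag_le : tag ≤ right

/-- `|a - b|` on `[0, ∞]`, with `|∞ - ∞| = 0` (the subtraction of `ℝ≥0∞` is truncated). -/
def absDiff (a b : ℝ≥0∞) : ℝ≥0∞ := max (a - b) (b - a)

/-- The cost of matching `[0, s, t)` to `[0, s', t')`, which is `max {|s - s'|, |t - t'|}`. -/
def TaggedInterval.cost (J J' : TaggedInterval) : ℝ≥0∞ :=
  max (absDiff J.tag J'.tag) (absDiff J.right J'.right)

/-- The weight `t / 2` of `[0, s, t)`. -/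
def TaggedInterval.weight (J : TaggedInterval) : ℝ≥0∞ := J.right / 2

/-- The bottleneck distance between finite multisets of tagged intervals. -/
def bottleneckDist (A B : Multiset TaggedInterval) : ℝ≥0∞ :=
  bottleneckDistOf TaggedInterval.cost TaggedInterval.weight A B

/-! ### Factored chain complexes and their tagged barcodes -/

section Chain

universe u

/-- A parametrized non-negatively graded chain complex over `F`. -/
abbrev ParamChain (F : Type u) [Field F] := ℝ≥0 ⥤ ChainComplex (ModuleCat.{u} F) ℕ

/-- A chain complex is compact if all its terms are finite-dimensional and only finitely many of
them are non-zero. -/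
def IsCompactComplex {F : Type u} [Field F] (D : ChainComplex (ModuleCat.{u} F) ℕ) : Prop :=
  (∀ i, Module.Finite F (D.X i)) ∧ {i | Nontrivial (D.X i)}.Finite

/-- Factored chain complexes: tame epimorphic parametrized compact chain complexes. -/
structure IsFactored {F : Type u} [Field F] (X : ParamChain F) : Prop where
  compact : ∀ t, IsCompactComplex (X.obj t)
  tame : Tame X
  epimorphic : Epimorphic X

/-- The condition under which the interval functor `I^n[0, s, t)` is `F`, and not `0`, at
parameter `r` in degree `k`: either `k = n` and `r < t`, or `k = n - 1` and `r < s`. -/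
def Alive (n : ℕ) (J : TaggedInterval) (r : ℝ≥0) (k : ℕ) : Prop :=
  (k = n ∧ (r : ℝ≥0∞) < J.right) ∨ (k + 1 = n ∧ (r : ℝ≥0∞) < J.tag)

theorem Alive.mono {n : ℕ} {J : TaggedInterval} {q r : ℝ≥0} {k : ℕ} (h : q ≤ r)
    (p : Alive n J r k) : Alive n J q k :=
  p.imp (fun p => ⟨p.1, lt_of_le_of_lt (ENNReal.coe_le_coe.2 h) p.2⟩)
    (fun p => ⟨p.1, lt_of_le_of_lt (ENNReal.coe_le_coe.2 h) p.2⟩)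

/-- The term of `I^n[0, s, t)^r` in degree `k`: the functions from proofs of `Alive n J r k` to
`F`. So it is `F` if this proposition holds and `0` if it does not. -/
abbrev IntervalTerm (F : Type u) (n : ℕ) (J : TaggedInterval) (r : ℝ≥0) (k : ℕ) : Type u :=
  PLift (Alive n J r k) → F

open scoped Classical in
/-- The differential of `I^n[0, s, t)^r` from degree `i` to degree `j`. From degree `n` to degree
`n - 1` it is the identity of `F` if both terms are `F`; in all other cases it is zero. -/
def intervalD (F : Type u) [Field F] (n : ℕ) (J : TaggedInterval) (r : ℝ≥0) (i j : ℕ) :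
    IntervalTerm F n J r i →ₗ[F] IntervalTerm F n J r j where
  toFun f _ :=
    if h : j + 1 = i ∧ i = n ∧ (r : ℝ≥0∞) < J.right then f ⟨Or.inl h.2⟩ else 0
  map_add' f g := by
    funext p
    by_cases h : j + 1 = i ∧ i = n ∧ (r : ℝ≥0∞) < J.right <;> simp [h]
  map_smul' a f := by
    funext p
    by_cases h : j + 1 = i ∧ i = n ∧ (r : ℝ≥0∞) < J.right <;> simp [h]

/-- The internal maps of `I^n[0, s, t)` in degree `k`, which restrict functions: the identity of
`F` if both terms are `F`, and zero otherwise. -/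
def intervalMap (F : Type u) [Field F] (n : ℕ) (J : TaggedInterval) {q r : ℝ≥0} (h : q ≤ r)
    (k : ℕ) : IntervalTerm F n J q k →ₗ[F] IntervalTerm F n J r k where
  toFun f p := f ⟨p.down.mono h⟩
  map_add' _ _ := rfl
  map_smul' _ _ := rfl

/-- The chain complex `I^n[0, s, t)^r`: it is the disk `D^n` for `r < s`, the sphere `S^n` for
`s ≤ r < t`, and `0` for `t ≤ r`. -/
def intervalComplex (F : Type u) [Field F] (n : ℕ) (J : TaggedInterval) (r : ℝ≥0) :
    ChainComplex (ModuleCat.{u} F) ℕ where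
  X k := ModuleCat.of F (IntervalTerm F n J r k)
  d i j := ModuleCat.ofHom (intervalD F n J r i j)
  shape i j hij := by
    refine ModuleCat.hom_ext (LinearMap.ext fun f => funext fun p => ?_)
    exact dif_neg fun h => hij h.1
  d_comp_d' i j k hij hjk := by
    refine ModuleCat.hom_ext (LinearMap.ext fun f => funext fun p => ?_)
    have hij' : j + 1 = i := hij
    change intervalD F n J r j k (intervalD F n J r i j f) p = 0
    by_cases h : i = n
    · exact dif_neg fun h' => by omega
    · have h0 : intervalD F n J r i j f = 0 := funext fun _ => dif_neg fun h' => h h'.2.1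
      rw [h0, map_zero]
      rfl

/-- The interval functor `I^n[0, s, t)`. -/
def intervalFunctor (F : Type u) [Field F] (n : ℕ) (J : TaggedInterval) : ParamChain F where
  obj r := intervalComplex F n J r
  map {q r} a :=
    { f := fun k => ModuleCat.ofHom (intervalMap F n J (leOfHom a) k)
      comm' := fun i j hij => by
        refine ModuleCat.hom_ext (LinearMap.ext fun f => funext fun p => ?_)
        have hij' : j + 1 = i := hij
        change intervalD F n J r i j (intervalMap F n J (leOfHom a) i f) p =
          intervalMap F n J (leOfHom a) j (intervalD F n J q i j f) p
        have hr : (r : ℝ≥0∞) < J.right := by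
          rcases p.down with p | p
          · exact p.2
          · exact lt_of_lt_of_le p.2 J.tag_le
        have hq : (q : ℝ≥0∞) < J.right :=
          lt_of_le_of_lt (ENNReal.coe_le_coe.2 (leOfHom a)) hr
        by_cases h : i = n <;> simp [intervalD, intervalMap, hij', h, hr, hq] }
  map_id _ := rfl
  map_comp _ _ := rfl

instance instHasFiniteBiproductsParamChain (F : Type u) [Field F] :
    HasFiniteBiproducts (ParamChain F) :=
  HasFiniteBiproducts.of_hasFiniteProducts

/-- `A = (A n)_n` is a tagged barcode of `X`: there is a finite family of interval functors
`I^{deg i}[0, s_i, t_i)`, where `s_i = 0` if `deg i = 0`, whose direct sum is isomorphic to `X`,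
and `A n` is the multiset of the tagged intervals of those with degree `n`. -/
def IsTaggedBarcode {F : Type u} [Field F] (X : ParamChain F)
    (A : ℕ → Multiset TaggedInterval) : Prop :=
  ∃ (m : ℕ) (deg : Fin m → ℕ) (J : Fin m → TaggedInterval),
    (∀ i, deg i = 0 → (J i).tag = 0) ∧
    Nonempty (X ≅ ⨁ fun i => intervalFunctor F (deg i) (J i)) ∧
    ∀ n, A n = (Finset.univ.filter (fun i => deg i = n)).val.map J

open scoped Classical in
/-- The tagged barcode of `X` (with the junk value `∅` if `X` has none). -/
def taggedBarcode {F : Type u} [Field F] (X : ParamChain F) : ℕ → Multiset TaggedInterval :=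
  if h : ∃ A, IsTaggedBarcode X A then h.choose else fun _ => 0

end Chain

end FactoredChain

end

/-!
All internal maps of a factored chain complex `X` are surjective, so `X` is the finite-dimensional
complex `X^0` together with an increasing family of subcomplexes, the kernels `vanishing X t` of
`X^0 ⟶ X^t`. The proof works throughout with `sumFunctor`, a direct sum of interval functors whose
terms are explicit products.

*Existence.* In degree `k`, the subspaces `vanishing X t k` form one chain, and the boundaries
together with the preimages of `vanishing X t (k - 1)` under the differential form another one. Two
chains of subspaces have a common adapted basis (`exists_adapted_basis`). Its vectors outside of
the boundaries generate the summands of degree `k`: the generator `x` yields the tagged interval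
whose right end is the parameter at which `x` vanishes, and whose tag is the one at which the
boundary of `x` vanishes (`IsFactored.exists_iso_sumFunctor`).

*Stability.* An `ε`-interleaving of direct sums of interval functors has, on the generators,
matrices `a` and `b` such that `b * a` is the identity on the tagged intervals longer than `2ε`.
Summands of different degrees do not interact, since generators of degree `n + 1` contribute only
boundaries in degree `n` (`sum_coeff_mul_coeff`). A nonzero entry between `[0, s, t)` and
`[0, s', t')` forces `s' ≤ s + ε` and `t' ≤ t + ε`. If `i ⟶ j ⟶ i'` are nonzero entries and `s + t`
is not larger at `i` than at `i'`, then `j` is `ε`-close to `i` or to `i'`. Hence, with the indices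
ordered by `s + t`, the part of the product `b * a` that passes through the neighbours of a set of
long tagged intervals is a unitriangular matrix, which gives Hall's condition
(`exists_injective_of_matrices`). The two partial injections supplied by Hall's theorem are merged
by a Schröder–Bernstein argument (`exists_matching_of_partial_injections`).

*Uniqueness* is stability for the identity as a `0`-interleaving: a matching of cost `0` is a
bijection of equal tagged intervals, because every tagged interval has positive length.

*The converse inequality* holds because a matching of cost at most `ε` defines an `ε`-interleaving
(`IsFamilyMatching.interleaved`). The maximum is attained because all but finitely many terms of a
tagged barcode are empty.
-/

namespace FactoredChain

/-! ### Matchings from partial injections -/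

/-- Given a partial injection `f` defined on `P` and a partial injection `g` in the other direction
defined on `Q`, both contained in the relation `R`, there is a matching contained in `R` that covers
both `P` and `Q`. This is the Knaster–Tarski proof of the Schröder–Bernstein theorem. -/
theorem exists_matching_of_partial_injections {ι κ : Type*} (R : ι → κ → Prop) (P : Set ι)
    (Q : Set κ) (f : ι → κ) (g : κ → ι) (hf : P.InjOn f) (hg : Q.InjOn g)
    (hfR : ∀ i ∈ P, R i (f i)) (hgR : ∀ j ∈ Q, R (g j) j) :
    ∃ M : ι → κ → Prop, (∀ i j, M i j → R i j) ∧ (∀ i j j', M i j → M i j' → j = j') ∧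
      (∀ i i' j, M i j → M i' j → i = i') ∧ (∀ i ∈ P, ∃ j, M i j) ∧ (∀ j ∈ Q, ∃ i, M i j) := by
  let Φ : Set ι →o Set ι :=
    { toFun := fun S => P \ g '' (Q \ f '' S)
      monotone' := fun S T h => Set.sdiff_subset_sdiff_right
        (Set.image_mono (Set.sdiff_subset_sdiff_right (Set.image_mono h))) }
  obtain ⟨S, hS⟩ : ∃ S, P \ g '' (Q \ f '' S) = S := ⟨Φ.lfp, Φ.map_lfp⟩
  have hSP : S ⊆ P := hS ▸ Set.sdiff_subset
  have hSg : ∀ j ∈ Q, j ∉ f '' S → g j ∉ S := by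
    intro j hj hjS h
    rw [← hS] at h
    exact h.2 ⟨j, ⟨hj, hjS⟩, rfl⟩
  refine ⟨fun i j => (i ∈ S ∧ f i = j) ∨ (j ∈ Q ∧ j ∉ f '' S ∧ g j = i), ?_, ?_, ?_, ?_, ?_⟩
  · rintro i j (⟨hi, rfl⟩ | ⟨hj, -, rfl⟩)
    · exact hfR i (hSP hi)
    · exact hgR j hj
  · rintro i j j' (⟨hi, rfl⟩ | ⟨hj, hj', rfl⟩) (⟨hi2, rfl⟩ | ⟨hj2, hj2', h⟩)
    · rfl
    · exact absurd (h ▸ hi) (hSg _ hj2 hj2')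
    · exact absurd hi2 (hSg _ hj hj')
    · exact (hg hj2 hj h).symm
  · rintro i i' j (⟨hi, rfl⟩ | ⟨hj, hj', rfl⟩) (⟨hi2, h⟩ | ⟨hj2, hj2', rfl⟩)
    · exact (hf (hSP hi2) (hSP hi) h).symm
    · exact absurd ⟨i, hi, rfl⟩ hj2'
    · exact absurd ⟨i', hi2, h⟩ hj'
    · rfl
  · intro i hi
    by_cases h : i ∈ S
    · exact ⟨f i, Or.inl ⟨h, rfl⟩⟩
    · rw [← hS] at h
      simp only [Set.mem_sdiff, hi, true_and, not_not] at h
      obtain ⟨j, ⟨hj, hj'⟩, rfl⟩ := h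
      exact ⟨j, Or.inr ⟨hj, hj', rfl⟩⟩
  · intro j hj
    by_cases h : j ∈ f '' S
    · obtain ⟨i, hi, rfl⟩ := h
      exact ⟨i, Or.inl ⟨hi, rfl⟩⟩
    · exact ⟨g j, Or.inr ⟨hj, h, rfl⟩⟩

/-! ### Hall's condition from a pair of matrices -/

/-- If `b * a` is the identity on the index set `P`, and if for indices with `α i ≤ α i'` every
nonzero product `b i' j * a j i` has `j` related to `i` or to `i'`, then Hall's condition holds
for `R` on `P`. Indeed, the matrix `a`, restricted to columns in `A ⊆ P` and to rows related to
`A`, has trivial kernel, because its product with the corresponding part of `b` is unitriangular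
for the order given by `α`. -/
theorem exists_injective_of_triangular {F : Type*} [Field F] {ι κ : Type*} [Fintype ι]
    [DecidableEq ι] [Fintype κ]
    (R : ι → κ → Prop) (P : Set ι) (α : ι → ℝ) (a : κ → ι → F) (b : ι → κ → F)
    (hba : ∀ i ∈ P, ∀ i' ∈ P, ∑ j, b i' j * a j i = if i' = i then 1 else 0)
    (hR : ∀ i ∈ P, ∀ i' ∈ P, α i ≤ α i' → ∀ j, a j i ≠ 0 → b i' j ≠ 0 → R i j ∨ R i' j) :
    ∃ f : P → κ, Function.Injective f ∧ ∀ i : P, R i (f i) := by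
  classical
  have key := (Finset.all_card_le_biUnion_card_iff_exists_injective
    (fun i : P => (Finset.univ : Finset κ).filter (R i))).1 ?_
  · obtain ⟨f, hf, hf'⟩ := key
    exact ⟨f, hf, fun i => by simpa using hf' i⟩
  intro A
  set N := A.biUnion fun i : P => (Finset.univ : Finset κ).filter (R i) with hN
  let T : (A → F) →ₗ[F] (N → F) :=
    { toFun := fun v j => ∑ i : A, a j i * v i
      map_add' := fun v w => by ext j; simp [mul_add, Finset.sum_add_distrib]
      map_smul' := fun c v => by
        ext j
        simp only [Pi.smul_apply, smul_eq_mul, RingHom.id_apply, Finset.mul_sum]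
        exact Finset.sum_congr rfl fun _ _ => by ring }
  have hT : Function.Injective T := by
    rw [← LinearMap.ker_eq_bot, LinearMap.ker_eq_bot']
    intro v hv
    by_contra hv0
    obtain ⟨i₀, hi₀⟩ : ∃ i, v i ≠ 0 := by
      by_contra! h
      exact hv0 (funext h)
    obtain ⟨i', hi', hmax⟩ := ((Finset.univ : Finset A).filter fun i => v i ≠ 0).exists_max_image
      (fun i => α i.1.1) ⟨i₀, by simpa using hi₀⟩
    simp only [Finset.mem_filter, Finset.mem_univ, true_and] at hi' hmax
    refine hi' ?_
    -- in the row of the maximal index of the support of `v`, restricting `j` to `N` does nothing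
    have h1 : ∀ i : A, v i ≠ 0 →
        ∑ j : N, b i'.1.1 j * a j i.1.1 = if i'.1.1 = i.1.1 then 1 else 0 := by
      intro i hi
      rw [← hba i.1.1 i.1.2 i'.1.1 i'.1.2,
        Finset.sum_coe_sort N (fun j => b i'.1.1 j * a j i.1.1)]
      refine Finset.sum_subset (Finset.subset_univ _) fun j _ hj => ?_
      by_contra h
      rcases hR i.1.1 i.1.2 i'.1.1 i'.1.2 (hmax i hi) j (right_ne_zero_of_mul h)
        (left_ne_zero_of_mul h) with h | h
      · exact hj (Finset.mem_biUnion.2 ⟨i.1, i.2, by simpa using h⟩)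
      · exact hj (Finset.mem_biUnion.2 ⟨i'.1, i'.2, by simpa using h⟩)
    have h2 : ∑ j : N, b i'.1.1 j * T v j = 0 := by simp [hv]
    have h3 : ∑ j : N, b i'.1.1 j * T v j =
        ∑ i : A, (∑ j : N, b i'.1.1 j * a j i.1.1) * v i := by
      simp only [T, LinearMap.coe_mk, AddHom.coe_mk, Finset.mul_sum, Finset.sum_mul]
      rw [Finset.sum_comm]
      exact Finset.sum_congr rfl fun _ _ => Finset.sum_congr rfl fun _ _ => by ring
    rw [h3, Finset.sum_eq_single i'] at h2
    · by_contra h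
      rw [h1 i' h, if_pos rfl, one_mul] at h2
      exact h h2
    · intro i _ hi
      by_cases hvi : v i = 0
      · simp [hvi]
      · rw [h1 i hvi, if_neg, zero_mul]
        exact fun h => hi (Subtype.ext (Subtype.ext h.symm))
    · exact fun h => absurd (Finset.mem_univ _) h
  have := LinearMap.finrank_le_finrank_of_injective hT
  simpa using this

/-! ### A basis adapted to two chains of subspaces -/

/-- Two chains of subspaces of a finite-dimensional space have a common adapted basis. The
induction splits off a hyperplane `H` that contains every proper member of the first chain, and
completes a basis of `H` by a vector of the smallest member of the second chain outside `H`. -/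
theorem exists_adapted_basis {F V : Type*} [Field F] [AddCommGroup V] [Module F V]
    [FiniteDimensional F V] (𝒦 ℒ : Set (Submodule F V)) (h𝒦 : IsChain (· ≤ ·) 𝒦)
    (hℒ : IsChain (· ≤ ·) ℒ) (W : Submodule F V) :
    ∃ E : Set V, LinearIndepOn F id E ∧ Submodule.span F E = W ∧
      (∀ K ∈ 𝒦, K ⊓ W ≤ Submodule.span F (E ∩ K)) ∧
      (∀ L ∈ ℒ, L ⊓ W ≤ Submodule.span F (E ∩ L)) := by
  induction W using WellFoundedLT.induction with
  | ind W ih =>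
  by_cases hW : W = ⊥
  · subst hW
    exact ⟨∅, linearIndepOn_empty _ _, by simp, by simp, by simp⟩
  -- the largest proper trace of the first chain on `W`
  obtain ⟨K₀, hK₀, hK₀'⟩ : ∃ K₀ < W, ∀ K ∈ 𝒦, K ⊓ W ≠ W → K ⊓ W ≤ K₀ := by
    by_cases hne : ({K | K ∈ 𝒦 ∧ K ⊓ W ≠ W} : Set (Submodule F V)).Nonempty
    · obtain ⟨_, ⟨K₁, ⟨hK₁, hK₁W⟩, rfl⟩, hm⟩ := WellFounded.has_min
        (wellFounded_gt (α := Submodule F V)) _ (hne.image (· ⊓ W))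
      refine ⟨K₁ ⊓ W, lt_of_le_of_ne inf_le_right hK₁W, fun K hK hKW => ?_⟩
      rcases h𝒦.total hK hK₁ with h | h
      · exact inf_le_inf_right _ h
      · by_contra h'
        exact hm (K ⊓ W) ⟨K, ⟨hK, hKW⟩, rfl⟩
          (lt_of_le_not_ge (inf_le_inf_right _ h) h')
    · refine ⟨⊥, bot_lt_iff_ne_bot.2 hW, fun K hK hKW => absurd ⟨K, hK, hKW⟩ hne⟩
  obtain ⟨H, hH, hHW⟩ := exists_le_covBy_of_lt hK₀
  obtain ⟨E, hE, hEs, hEK, hEL⟩ := ih H hHW.lt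
  -- a vector in the smallest trace of the second chain that is not contained in `H`
  obtain ⟨x, hxW, hxH, hxL⟩ : ∃ x ∈ W, x ∉ H ∧ ∀ L ∈ ℒ, ¬ L ⊓ W ≤ H → x ∈ L := by
    by_cases hne : ({L | L ∈ ℒ ∧ ¬ L ⊓ W ≤ H} : Set (Submodule F V)).Nonempty
    · obtain ⟨L₁, ⟨hL₁, hL₁H⟩, hm⟩ := WellFounded.has_min
        (wellFounded_lt (α := Submodule F V)) _ hne
      obtain ⟨x, hx, hxH⟩ := SetLike.not_le_iff_exists.1 hL₁H
      refine ⟨x, hx.2, hxH, fun L hL hLH => ?_⟩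
      rcases hℒ.total hL hL₁ with h | h
      · by_contra hxL
        exact hm L ⟨hL, hLH⟩ (lt_of_le_of_ne h fun h => hxL (h ▸ hx.1))
      · exact h hx.1
    · obtain ⟨x, hx, hxH⟩ := SetLike.exists_of_lt hHW.lt
      exact ⟨x, hx, hxH, fun L hL hLH => absurd ⟨L, hL, hLH⟩ hne⟩
  have hHx : H ⊔ Submodule.span F {x} = W := by
    refine (hHW.eq_or_eq le_sup_left
      (sup_le hHW.le ((Submodule.span_singleton_le_iff_mem _ _).2 hxW))).resolve_left
      fun h => hxH ?_
    rw [← h]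
    exact Submodule.mem_sup_right (Submodule.mem_span_singleton_self x)
  -- both chains are handled by the same modular-law computation
  have hstep : ∀ N : Submodule F V, N ⊓ H ≤ Submodule.span F (E ∩ N) →
      (¬ N ⊓ W ≤ H → x ∈ N) → N ⊓ W ≤ Submodule.span F (insert x E ∩ N) := by
    intro N hN hxN
    by_cases h : N ⊓ W ≤ H
    · exact (le_inf inf_le_left h).trans (hN.trans (Submodule.span_mono
        (Set.inter_subset_inter_left _ (Set.subset_insert _ _))))
    · have hxN' := hxN h
      rw [← hHx]
      intro y hy
      obtain ⟨hyN, hy⟩ := hy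
      obtain ⟨z, hz, w, hw, rfl⟩ := Submodule.mem_sup.1 hy
      obtain ⟨c, rfl⟩ := Submodule.mem_span_singleton.1 hw
      have hzN : z ∈ N := by
        have := N.sub_mem hyN (N.smul_mem c hxN')
        simpa using this
      refine Submodule.add_mem _ (Submodule.span_mono
        (Set.inter_subset_inter_left _ (Set.subset_insert _ _)) (hN ⟨hzN, hz⟩)) ?_
      exact Submodule.smul_mem _ _ (Submodule.subset_span ⟨Set.mem_insert _ _, hxN'⟩)
  refine ⟨insert x E, ?_, ?_, fun K hK => hstep K (hEK K hK) fun h => ?_,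
    fun L hL => hstep L (hEL L hL) (hxL L hL)⟩
  · refine hE.id_insert ?_
    rwa [hEs]
  · rw [Submodule.span_insert, hEs, sup_comm, hHx]
  · have : K ⊓ W = W := by
      by_contra h'
      exact h ((hK₀' K hK h').trans hH)
    rw [inf_eq_right] at this
    exact this hxW

/-! ### Matchings between families of tagged intervals -/

theorem absDiff_le_iff {a b : ℝ≥0∞} {ε : ℝ≥0} :
    absDiff a b ≤ ε ↔ a ≤ b + ε ∧ b ≤ a + ε := by
  simp [absDiff, add_comm]

theorem TaggedInterval.cost_le_iff {J J' : TaggedInterval} {ε : ℝ≥0} :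
    J.cost J' ≤ ε ↔ (J.tag ≤ J'.tag + ε ∧ J'.tag ≤ J.tag + ε) ∧
      J.right ≤ J'.right + ε ∧ J'.right ≤ J.right + ε := by
  simp [TaggedInterval.cost, absDiff_le_iff]

theorem TaggedInterval.weight_le_iff {J : TaggedInterval} {ε : ℝ≥0} :
    J.weight ≤ ε ↔ J.right ≤ ε + ε := by
  rw [TaggedInterval.weight, ENNReal.div_le_iff_le_mul (by simp) (by simp), mul_two]

/-- `R` is a degree-preserving matching of cost at most `ε` between the indices of two finite
families of tagged intervals with degrees. -/
structure IsFamilyMatching {ι κ : Type*} (ε : ℝ≥0) (deg : ι → ℕ) (J : ι → TaggedInterval)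
    (deg' : κ → ℕ) (J' : κ → TaggedInterval) (R : ι → κ → Prop) : Prop where
  right_unique : ∀ i j j', R i j → R i j' → j = j'
  left_unique : ∀ i i' j, R i j → R i' j → i = i'
  deg_eq : ∀ i j, R i j → deg i = deg' j
  cost_le : ∀ i j, R i j → (J i).cost (J' j) ≤ ε
  left_le : ∀ i, (∀ j, ¬ R i j) → (J i).right ≤ ε + ε
  right_le : ∀ j, (∀ i, ¬ R i j) → (J' j).right ≤ ε + ε

theorem IsFamilyMatching.symm {ι κ : Type*} {ε : ℝ≥0} {deg : ι → ℕ} {J : ι → TaggedInterval}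
    {deg' : κ → ℕ} {J' : κ → TaggedInterval} {R : ι → κ → Prop}
    (h : IsFamilyMatching ε deg J deg' J' R) :
    IsFamilyMatching ε deg' J' deg J (fun j i => R i j) where
  right_unique j i i' := h.left_unique i i' j
  left_unique j j' i := h.right_unique i j j'
  deg_eq j i hij := (h.deg_eq i j hij).symm
  cost_le j i hij := by
    have := h.cost_le i j hij
    rw [TaggedInterval.cost_le_iff] at this ⊢
    exact ⟨this.1.symm, this.2.symm⟩
  left_le := h.right_le
  right_le := h.left_le

/-- Truncation of `[0, ∞]` at a finite level. -/
noncomputable def trunc (N : ℝ≥0) (x : ℝ≥0∞) : ℝ := (min x N).toReal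

theorem trunc_le_trunc_add {N ε : ℝ≥0} {x y : ℝ≥0∞} (h : x ≤ y + ε) :
    trunc N x ≤ trunc N y + ε := by
  have hN : ∀ z : ℝ≥0∞, min z N ≠ ∞ := fun z => ne_top_of_le_ne_top ENNReal.coe_ne_top
    (min_le_right _ _)
  rw [trunc, trunc, ← ENNReal.coe_toReal, ← ENNReal.toReal_add (hN _) ENNReal.coe_ne_top]
  refine ENNReal.toReal_mono (ENNReal.add_ne_top.2 ⟨hN _, ENNReal.coe_ne_top⟩) ?_
  rw [min_add]
  exact min_le_min h le_self_add

/-- Truncation at a level above `y + ε` reflects the inequality `x ≤ y + ε`; an infinite `y` needs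
no assumption on the level. -/
theorem le_add_of_trunc_le {N ε : ℝ≥0} {x y : ℝ≥0∞} (hy : y ≠ ∞ → y + ε < N)
    (h : trunc N x ≤ trunc N y + ε) : x ≤ y + ε := by
  by_cases hy' : y = ∞
  · simp [hy']
  have hN : ∀ z : ℝ≥0∞, min z N ≠ ∞ := fun z => ne_top_of_le_ne_top ENNReal.coe_ne_top
    (min_le_right _ _)
  by_contra! hx
  rw [trunc, trunc, ← ENNReal.coe_toReal, ← ENNReal.toReal_add (hN _) ENNReal.coe_ne_top,
    ENNReal.toReal_le_toReal (hN _) (ENNReal.add_ne_top.2 ⟨hN _, ENNReal.coe_ne_top⟩)] at h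
  have h1 : y + ε < min x N := lt_min hx (hy hy')
  exact (h1.trans_le h).not_ge (by gcongr; exact min_le_left _ _)

theorem exists_trunc_level {ι : Type*} [Fintype ι] (v : ι → ℝ≥0∞) (ε : ℝ≥0) :
    ∃ N₀ : ℝ≥0, ∀ N ≥ N₀, ∀ i, v i ≠ ∞ → v i + ε < N := by
  refine ⟨∑ i, (v i).toNNReal + ε + 1, fun N hN i hi => ?_⟩
  rw [← ENNReal.coe_toNNReal hi]
  norm_cast
  refine lt_of_lt_of_le ?_ hN
  have := Finset.single_le_sum (f := fun i => (v i).toNNReal) (fun _ _ => zero_le)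
    (Finset.mem_univ i)
  exact lt_of_le_of_lt (add_le_add_left this ε) (lt_add_one _)

/-- The Hall-type half of algebraic stability: matrices that behave like the matrices of an
interleaving give a partial injection. The indices are ordered by `s + t`, after truncation of
`∞` to a large real number; the inequalities imposed by nonzero entries then show that a `j` lying
between `i` and `i'` with `s + t` not larger at `i` than at `i'` is `ε`-close to one of them. -/
theorem exists_injective_of_matrices {F : Type*} [Field F] {ι κ : Type*} [Fintype ι]
    [DecidableEq ι] [Fintype κ] (ε : ℝ≥0) (deg : ι → ℕ) (J : ι → TaggedInterval)
    (deg' : κ → ℕ) (J' : κ → TaggedInterval) (a : κ → ι → F) (b : ι → κ → F)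
    (ha : ∀ j i, a j i ≠ 0 → deg i = deg' j ∧ (J' j).tag ≤ (J i).tag + ε ∧
      (J' j).right ≤ (J i).right + ε)
    (hb : ∀ i j, b i j ≠ 0 → (J i).tag ≤ (J' j).tag + ε ∧ (J i).right ≤ (J' j).right + ε)
    (hbdeg : ∀ i j, b i j ≠ 0 → deg' j = deg i)
    (hba : ∀ i i', ((ε + ε : ℝ≥0) : ℝ≥0∞) < (J i').right →
      ∑ j, b i' j * a j i = if i' = i then 1 else 0) :
    ∃ f : {i | ((ε + ε : ℝ≥0) : ℝ≥0∞) < (J i).right} → κ, Function.Injective f ∧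
      ∀ i : {i | ((ε + ε : ℝ≥0) : ℝ≥0∞) < (J i).right},
        deg i = deg' (f i) ∧ (J i).cost (J' (f i)) ≤ ε := by
  obtain ⟨N₁, h₁⟩ := exists_trunc_level (fun i => (J i).tag) ε
  obtain ⟨N₂, h₂⟩ := exists_trunc_level (fun i => (J i).right) ε
  obtain ⟨N₃, h₃⟩ := exists_trunc_level (fun j => (J' j).tag) ε
  obtain ⟨N₄, h₄⟩ := exists_trunc_level (fun j => (J' j).right) ε
  set N := N₁ + N₂ + N₃ + N₄
  have hN₁ := h₁ N (by simp only [N, add_assoc]; exact le_self_add)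
  have hN₂ := h₂ N (by
    simp only [N, add_assoc]; exact le_add_left le_self_add)
  have hN₃ := h₃ N (by simp only [N]; exact le_add_right le_add_self)
  have hN₄ := h₄ N le_add_self
  refine exists_injective_of_triangular (fun i j => deg i = deg' j ∧ (J i).cost (J' j) ≤ ε) _
    (fun i => trunc N (J i).tag + trunc N (J i).right) a b (fun i _ i' hi' => hba i i' hi') ?_
  intro i _ i' _ hα j haj hbj
  obtain ⟨hd, a₁, a₂⟩ := ha j i haj
  obtain ⟨b₁, b₂⟩ := hb i' j hbj
  have hd' := hbdeg i' j hbj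
  by_contra! hcon
  obtain ⟨hc, hc'⟩ := hcon
  have hc := hc hd
  have hc' := hc' hd'.symm
  rw [lt_iff_not_ge, TaggedInterval.cost_le_iff] at hc hc'
  have a₁' := trunc_le_trunc_add (N := N) a₁
  have a₂' := trunc_le_trunc_add (N := N) a₂
  have b₁' := trunc_le_trunc_add (N := N) b₁
  have b₂' := trunc_le_trunc_add (N := N) b₂
  have e₁ : trunc N (J' j).tag + ε < trunc N (J i).tag ∨
      trunc N (J' j).right + ε < trunc N (J i).right := by
    by_contra! h
    exact hc ⟨⟨le_add_of_trunc_le (hN₃ j) h.1, a₁⟩, le_add_of_trunc_le (hN₄ j) h.2, a₂⟩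
  have e₂ : trunc N (J i').tag + ε < trunc N (J' j).tag ∨
      trunc N (J i').right + ε < trunc N (J' j).right := by
    by_contra! h
    exact hc' ⟨⟨b₁, le_add_of_trunc_le (hN₁ i') h.1⟩, b₂, le_add_of_trunc_le (hN₂ i') h.2⟩
  have := ε.2
  rcases e₁ with e₁ | e₁ <;> rcases e₂ with e₂ | e₂ <;> linarith

/-- Matrices that behave like the matrices of an `ε`-interleaving yield a matching of cost at most
`ε`. -/
theorem exists_isFamilyMatching_of_matrices {F : Type*} [Field F] {ι κ : Type*} [Fintype ι]
    [DecidableEq ι] [Fintype κ] [DecidableEq κ] (ε : ℝ≥0) (deg : ι → ℕ)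
    (J : ι → TaggedInterval) (deg' : κ → ℕ) (J' : κ → TaggedInterval) (a : κ → ι → F)
    (b : ι → κ → F)
    (ha : ∀ j i, a j i ≠ 0 → deg i = deg' j ∧ (J' j).tag ≤ (J i).tag + ε ∧
      (J' j).right ≤ (J i).right + ε)
    (hb : ∀ i j, b i j ≠ 0 → deg' j = deg i ∧ (J i).tag ≤ (J' j).tag + ε ∧
      (J i).right ≤ (J' j).right + ε)
    (hba : ∀ i i', ((ε + ε : ℝ≥0) : ℝ≥0∞) < (J i').right →
      ∑ j, b i' j * a j i = if i' = i then 1 else 0)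
    (hab : ∀ j j', ((ε + ε : ℝ≥0) : ℝ≥0∞) < (J' j').right →
      ∑ i, a j' i * b i j = if j' = j then 1 else 0) :
    ∃ R : ι → κ → Prop, IsFamilyMatching ε deg J deg' J' R := by
  obtain ⟨f, hf, hf'⟩ := exists_injective_of_matrices ε deg J deg' J' a b ha
    (fun i j h => (hb i j h).2) (fun i j h => (hb i j h).1) hba
  obtain ⟨g, hg, hg'⟩ := exists_injective_of_matrices ε deg' J' deg J b a hb
    (fun i j h => (ha i j h).2) (fun i j h => (ha i j h).1) hab
  by_cases hκ : Nonempty κ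
  swap
  · refine ⟨fun _ _ => False, by simp, by simp, by simp, by simp, fun i _ => ?_,
      fun j => absurd ⟨j⟩ hκ⟩
    by_contra! h
    exact hκ ⟨f ⟨i, by simpa using h⟩⟩
  by_cases hι : Nonempty ι
  swap
  · refine ⟨fun _ _ => False, by simp, by simp, by simp, by simp, fun i => absurd ⟨i⟩ hι,
      fun j _ => ?_⟩
    by_contra! h
    exact hι ⟨g ⟨j, by simpa using h⟩⟩
  let P := {i | ((ε + ε : ℝ≥0) : ℝ≥0∞) < (J i).right}
  let Q := {j | ((ε + ε : ℝ≥0) : ℝ≥0∞) < (J' j).right}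
  let f' : ι → κ := Function.extend Subtype.val f fun _ => hκ.some
  let g' : κ → ι := Function.extend Subtype.val g fun _ => hι.some
  have hf1 : ∀ i : P, f' i = f i := Subtype.val_injective.extend_apply _ _
  have hg1 : ∀ j : Q, g' j = g j := Subtype.val_injective.extend_apply _ _
  obtain ⟨M, hMR, h1, h2, h3, h4⟩ := exists_matching_of_partial_injections
    (fun i j => deg i = deg' j ∧ (J i).cost (J' j) ≤ ε) P Q f' g'
    (fun i hi i' hi' h => by
      rw [hf1 ⟨i, hi⟩, hf1 ⟨i', hi'⟩] at h
      exact congrArg Subtype.val (hf h))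
    (fun i hi i' hi' h => by
      rw [hg1 ⟨i, hi⟩, hg1 ⟨i', hi'⟩] at h
      exact congrArg Subtype.val (hg h))
    (fun i hi => by rw [hf1 ⟨i, hi⟩]; exact hf' ⟨i, hi⟩)
    (fun j hj => by
      rw [hg1 ⟨j, hj⟩]
      obtain ⟨hd, hc⟩ := hg' ⟨j, hj⟩
      rw [TaggedInterval.cost_le_iff] at hc ⊢
      exact ⟨hd.symm, hc.1.symm, hc.2.symm⟩)
  refine ⟨M, h1, h2, fun i j h => (hMR i j h).1, fun i j h => (hMR i j h).2,
    fun i hi => ?_, fun j hj => ?_⟩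
  · by_contra! h
    obtain ⟨j, hj⟩ := h3 i (by simpa [P] using h)
    exact hi j hj
  · by_contra! h
    obtain ⟨i, hi⟩ := h4 j (by simpa [Q] using h)
    exact hj i hi

/-- The multiset of the tagged intervals of degree `n` of a finite family. -/
def degreePart {ι : Type*} [Fintype ι] (deg : ι → ℕ) (J : ι → TaggedInterval) (n : ℕ) :
    Multiset TaggedInterval :=
  (Finset.univ.filter (fun i => deg i = n)).val.map J

theorem degreePart_eq {ι : Type*} [Fintype ι] (deg : ι → ℕ) (J : ι → TaggedInterval) (n : ℕ) :
    degreePart deg J n =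
      (Finset.univ : Finset {i // deg i = n}).val.map (fun i => J i.1) := by
  rw [degreePart, ← Finset.univ_val_map_subtype_val, Multiset.map_map]
  rfl

open scoped Classical in
theorem exists_toType_equiv {S ι : Type*} [Fintype ι] (g : ι → S) :
    ∃ e : ((Finset.univ : Finset ι).val.map g).ToType ≃ ι, ∀ a, g (e a) = a.1 := by
  let e₁ : (Finset.univ : Finset ι).val.ToType ≃ ι := Equiv.ofBijective (fun a => a.1) (by
    constructor
    · rintro ⟨x, k⟩ ⟨y, l⟩ (rfl : x = y)
      have hx : (Finset.univ : Finset ι).val.count x = 1 :=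
        Multiset.count_eq_one_of_mem Finset.univ.nodup (Finset.mem_univ x)
      have : k = l := by
        apply Fin.ext
        have := k.2
        have := l.2
        omega
      rw [this]
    · intro x
      exact ⟨⟨x, ⟨0, Multiset.count_pos.2 (Finset.mem_univ x)⟩⟩, rfl⟩)
  let e₂ := Multiset.mapEquiv (Finset.univ : Finset ι).val g
  refine ⟨e₂.symm.trans e₁, fun a => ?_⟩
  obtain ⟨b, rfl⟩ := e₂.surjective a
  simp only [Equiv.trans_apply, Equiv.symm_apply_apply]
  exact (Multiset.mapEquiv_apply _ g b).symm

/-- The elements of `degreePart deg J n`, counted with multiplicity, correspond to the indices of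
degree `n`. The decidable equality in `Multiset.ToType` is the classical one that occurs in
`IsMatching`. -/
theorem exists_degreePart_equiv {ι : Type*} [Fintype ι] (deg : ι → ℕ) (J : ι → TaggedInterval)
    (n : ℕ) : ∃ e : @Multiset.ToType _ (fun a b => Classical.propDecidable (a = b))
      (degreePart deg J n) ≃ {i // deg i = n}, ∀ a, J (e a) = a.1 := by
  rw [degreePart_eq]
  exact exists_toType_equiv fun i : {i // deg i = n} => J i.1

theorem matchingCost_le_iff {A B : Multiset TaggedInterval} {ε : ℝ≥0}
    (M : Set (@Multiset.ToType _ (fun a b => Classical.propDecidable (a = b)) A ×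
      @Multiset.ToType _ (fun a b => Classical.propDecidable (a = b)) B)) :
    matchingCost TaggedInterval.cost TaggedInterval.weight M ≤ ε ↔
      (∀ I J, (I, J) ∈ M → TaggedInterval.cost I.1 J.1 ≤ ε) ∧
      (∀ I, (∀ J, (I, J) ∉ M) → TaggedInterval.right I.1 ≤ ε + ε) ∧
      (∀ J, (∀ I, (I, J) ∉ M) → TaggedInterval.right J.1 ≤ ε + ε) := by
  simp only [matchingCost, sup_le_iff, iSup_le_iff, TaggedInterval.weight_le_iff]

theorem IsFamilyMatching.bottleneckDist_le {ι κ : Type*} [Fintype ι] [Fintype κ] {ε : ℝ≥0}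
    {deg : ι → ℕ} {J : ι → TaggedInterval} {deg' : κ → ℕ} {J' : κ → TaggedInterval}
    {R : ι → κ → Prop} (h : IsFamilyMatching ε deg J deg' J' R) (n : ℕ) :
    bottleneckDist (degreePart deg J n) (degreePart deg' J' n) ≤ ε := by
  obtain ⟨e, he⟩ := exists_degreePart_equiv deg J n
  obtain ⟨e', he'⟩ := exists_degreePart_equiv deg' J' n
  refine iInf₂_le_of_le {p | R (e p.1) (e' p.2)} ⟨?_, ?_⟩ ((matchingCost_le_iff _).2 ⟨?_, ?_, ?_⟩)
  · intro I K K' h1 h2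
    exact e'.injective (Subtype.ext (h.right_unique _ _ _ h1 h2))
  · intro I I' K h1 h2
    exact e.injective (Subtype.ext (h.left_unique _ _ _ h1 h2))
  · intro I K hIK
    rw [← he, ← he']
    exact h.cost_le _ _ hIK
  · intro I hI
    rw [← he]
    refine h.left_le _ fun j hj => ?_
    have hd : deg' j = n := (h.deg_eq _ _ hj).symm.trans (e I).2
    refine hI (e'.symm ⟨j, hd⟩) ?_
    simpa using hj
  · intro K hK
    rw [← he']
    refine h.right_le _ fun i hi => ?_
    have hd : deg i = n := (h.deg_eq _ _ hi).trans (e' K).2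
    refine hK (e.symm ⟨i, hd⟩) ?_
    simpa using hi

theorem exists_isFamilyMatching_of_bottleneckDist_lt {ι κ : Type*} [Fintype ι] [Fintype κ]
    {ε : ℝ≥0} {deg : ι → ℕ} {J : ι → TaggedInterval} {deg' : κ → ℕ} {J' : κ → TaggedInterval}
    (h : ∀ n, bottleneckDist (degreePart deg J n) (degreePart deg' J' n) < ε) :
    ∃ R : ι → κ → Prop, IsFamilyMatching ε deg J deg' J' R := by
  choose e he using exists_degreePart_equiv deg J
  choose e' he' using exists_degreePart_equiv deg' J'
  have h' : ∀ n, ∃ M, IsMatching (A := degreePart deg J n) (B := degreePart deg' J' n) M ∧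
      matchingCost TaggedInterval.cost TaggedInterval.weight M ≤ ε := by
    intro n
    obtain ⟨M, hM⟩ := iInf_lt_iff.1 (h n)
    obtain ⟨hM, hM'⟩ := iInf_lt_iff.1 hM
    exact ⟨M, hM, hM'.le⟩
  choose M hM hMc using h'
  have hMc := fun n => (matchingCost_le_iff (M n)).1 (hMc n)
  refine ⟨fun i j => ∃ n, ∃ (hi : deg i = n) (hj : deg' j = n),
    ((e n).symm ⟨i, hi⟩, (e' n).symm ⟨j, hj⟩) ∈ M n, ?_, ?_, ?_, ?_, ?_, ?_⟩
  · rintro i j j' ⟨n, hi, hj, h1⟩ ⟨n', hi', hj', h2⟩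
    obtain rfl : n = n' := hi.symm.trans hi'
    exact congrArg Subtype.val ((e' n).symm.injective ((hM n).1 _ _ _ h1 h2))
  · rintro i i' j ⟨n, hi, hj, h1⟩ ⟨n', hi', hj', h2⟩
    obtain rfl : n = n' := hj.symm.trans hj'
    exact congrArg Subtype.val ((e n).symm.injective ((hM n).2 _ _ _ h1 h2))
  · rintro i j ⟨n, hi, hj, -⟩
    exact hi.trans hj.symm
  · rintro i j ⟨n, hi, hj, h1⟩
    simpa [← he, ← he'] using (hMc n).1 _ _ h1
  · intro i hi
    have := (hMc (deg i)).2.1 ((e (deg i)).symm ⟨i, rfl⟩) fun K hK =>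
      hi (e' _ K) ⟨deg i, rfl, (e' _ K).2, by simpa using hK⟩
    simpa [← he] using this
  · intro j hj
    have := (hMc (deg' j)).2.2 ((e' (deg' j)).symm ⟨j, rfl⟩) fun K hK =>
      hj (e _ K) ⟨deg' j, (e _ K).2, rfl, by simpa using hK⟩
    simpa [← he'] using this

theorem TaggedInterval.eq_of_cost_le_zero {J J' : TaggedInterval} (h : J.cost J' ≤ (0 : ℝ≥0)) :
    J = J' := by
  rw [TaggedInterval.cost_le_iff] at h
  simp only [ENNReal.coe_zero, add_zero] at h
  exact TaggedInterval.ext (le_antisymm h.1.1 h.1.2) (le_antisymm h.2.1 h.2.2)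

/-- As all tagged intervals have positive length, a matching of cost `0` is a bijection of equal
tagged intervals. -/
theorem IsFamilyMatching.degreePart_eq {ι κ : Type*} [Fintype ι] [Fintype κ]
    {deg : ι → ℕ} {J : ι → TaggedInterval} {deg' : κ → ℕ} {J' : κ → TaggedInterval}
    {R : ι → κ → Prop} (h : IsFamilyMatching 0 deg J deg' J' R) (n : ℕ) :
    degreePart deg J n = degreePart deg' J' n := by
  have h1 : ∀ i, ∃ j, R i j := by
    intro i
    by_contra! hi
    exact (J i).right_pos.not_ge (by simpa using h.left_le i hi)
  have h2 : ∀ j, ∃ i, R i j := by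
    intro j
    by_contra! hj
    exact (J' j).right_pos.not_ge (by simpa using h.right_le j hj)
  choose f hf using h1
  choose g hg using h2
  let e : ι ≃ κ := ⟨f, g, fun i => h.left_unique _ _ _ (hg _) (hf _),
    fun j => h.right_unique _ _ _ (hf _) (hg _)⟩
  refine Multiset.map_eq_map_of_bij_of_nodup _ _ (Finset.nodup _) (Finset.nodup _)
    (fun i _ => e i) ?_ (fun _ _ _ _ h => e.injective h) ?_ ?_
  · intro i hi
    simpa [e, ← h.deg_eq _ _ (hf i)] using hi
  · intro j hj
    refine ⟨e.symm j, ?_, e.apply_symm_apply j⟩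
    simpa [e, h.deg_eq _ _ (hg j)] using hj
  · intro i _
    exact TaggedInterval.eq_of_cost_le_zero (h.cost_le _ _ (hf i))

/-! ### A concrete model of direct sums of interval functors -/

section SumFunctor

universe u

variable (F : Type u) [Field F] {ι : Type} (deg : ι → ℕ) (J : ι → TaggedInterval)

/-- The terms of the direct sum of the interval functors `I^{deg i}[0, s_i, t_i)`. -/
abbrev SumTerm (r : ℝ≥0) (k : ℕ) : Type u := ∀ i, IntervalTerm F (deg i) (J i) r k

/-- The differentials of the direct sum of a family of interval functors. -/
noncomputable def sumD (r : ℝ≥0) (k l : ℕ) : SumTerm F deg J r k →ₗ[F] SumTerm F deg J r l :=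
  LinearMap.pi fun i => intervalD F (deg i) (J i) r k l ∘ₗ LinearMap.proj i

/-- The internal maps of the direct sum of a family of interval functors. -/
noncomputable def sumMap {q r : ℝ≥0} (h : q ≤ r) (k : ℕ) :
    SumTerm F deg J q k →ₗ[F] SumTerm F deg J r k :=
  LinearMap.pi fun i => intervalMap F (deg i) (J i) h k ∘ₗ LinearMap.proj i

/-- The direct sum of a family of interval functors, as a functor whose terms are products. -/
noncomputable def sumFunctor : ParamChain F where
  obj r :=
    { X := fun k => ModuleCat.of F (SumTerm F deg J r k)
      d := fun k l => ModuleCat.ofHom (sumD F deg J r k l)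
      shape := fun k l h => ModuleCat.hom_ext <| LinearMap.ext fun f => funext fun i =>
        LinearMap.congr_fun
          (ModuleCat.hom_ext_iff.1 ((intervalComplex F (deg i) (J i) r).shape k l h)) (f i)
      d_comp_d' := fun k l m _ _ => ModuleCat.hom_ext <| LinearMap.ext fun f => funext fun i =>
        LinearMap.congr_fun
          (ModuleCat.hom_ext_iff.1 ((intervalComplex F (deg i) (J i) r).d_comp_d k l m)) (f i) }
  map a :=
    { f := fun k => ModuleCat.ofHom (sumMap F deg J (leOfHom a) k)
      comm' := fun k l _ => ModuleCat.hom_ext <| LinearMap.ext fun f => funext fun i =>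
        LinearMap.congr_fun
          (ModuleCat.hom_ext_iff.1 (((intervalFunctor F (deg i) (J i)).map a).comm k l)) (f i) }
  map_id _ := rfl
  map_comp _ _ := rfl

/-- The projections of `sumFunctor` onto its summands. -/
noncomputable def sumProj (i : ι) : sumFunctor F deg J ⟶ intervalFunctor F (deg i) (J i) where
  app _ :=
    { f := fun _ => ModuleCat.ofHom (LinearMap.proj i)
      comm' := fun _ _ _ => rfl }
  naturality _ _ _ := rfl

/-- The inclusions of the summands into `sumFunctor`. -/
noncomputable def sumIncl [DecidableEq ι] (i : ι) :
    intervalFunctor F (deg i) (J i) ⟶ sumFunctor F deg J where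
  app r :=
    { f := fun k => ModuleCat.ofHom
        (LinearMap.single F (fun i => IntervalTerm F (deg i) (J i) r k) i)
      comm' := fun k l _ => by
        refine ModuleCat.hom_ext <| LinearMap.ext fun f => funext fun i' => ?_
        exact Pi.apply_single (fun i => intervalD F (deg i) (J i) r k l) (fun _ => map_zero _)
          i f i' }
  naturality _ r a := by
    refine HomologicalComplex.hom_ext _ _ fun k => ModuleCat.hom_ext <| LinearMap.ext fun f =>
      funext fun i' => ?_
    exact (Pi.apply_single (fun i => intervalMap F (deg i) (J i) (leOfHom a) k)
      (fun _ => map_zero _) i f i').symm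

variable {F} in
theorem sum_f_apply {C D : ChainComplex (ModuleCat.{u} F) ℕ} (s : Finset ι) (g : ι → (C ⟶ D))
    (k : ℕ) (x : C.X k) : ((∑ i ∈ s, g i).f k).hom x = ∑ i ∈ s, ((g i).f k).hom x :=
  map_sum ({ toFun := fun g : C ⟶ D => (g.f k).hom x
             map_zero' := rfl
             map_add' := fun _ _ => rfl } : (C ⟶ D) →+ D.X k) g s

/-- `sumFunctor` is a direct sum of interval functors. -/
theorem nonempty_biproduct_iso_sumFunctor [Finite ι] :
    Nonempty ((⨁ fun i => intervalFunctor F (deg i) (J i)) ≅ sumFunctor F deg J) := by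
  classical
  have := Fintype.ofFinite ι
  let b : Bicone fun i => intervalFunctor F (deg i) (J i) :=
    { pt := sumFunctor F deg J
      π := sumProj F deg J
      ι := sumIncl F deg J
      ι_π := fun i i' => by
        split_ifs with h
        · subst h
          refine NatTrans.ext (funext fun r => HomologicalComplex.hom_ext _ _ fun k =>
            ModuleCat.hom_ext <| LinearMap.ext fun f => ?_)
          exact Pi.single_eq_same (M := fun i => IntervalTerm F (deg i) (J i) r k) i f
        · refine NatTrans.ext (funext fun r => HomologicalComplex.hom_ext _ _ fun k =>
            ModuleCat.hom_ext <| LinearMap.ext fun f => ?_)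
          exact Pi.single_eq_of_ne' (M := fun i => IntervalTerm F (deg i) (J i) r k) h f }
  refine ⟨(biproduct.uniqueUpToIso _ (isBilimitOfTotal b ?_)).symm⟩
  refine NatTrans.ext (funext fun r => HomologicalComplex.hom_ext _ _ fun k =>
    ModuleCat.hom_ext <| LinearMap.ext fun f => ?_)
  rw [NatTrans.app_sum, sum_f_apply]
  exact Finset.univ_sum_single (M := fun i => IntervalTerm F (deg i) (J i) r k) f

variable {F deg J}

/-- A family of degrees and tagged intervals describes a tagged barcode of `X` if and only if `X`
is isomorphic to its `sumFunctor`. -/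
theorem isTaggedBarcode_iff {X : ParamChain F} {A : ℕ → Multiset TaggedInterval} :
    IsTaggedBarcode X A ↔ ∃ (m : ℕ) (deg : Fin m → ℕ) (J : Fin m → TaggedInterval),
      (∀ i, deg i = 0 → (J i).tag = 0) ∧ Nonempty (X ≅ sumFunctor F deg J) ∧
      A = degreePart deg J := by
  refine exists_congr fun m => exists_congr fun deg => exists_congr fun J =>
    and_congr_right fun _ => and_congr ?_ ?_
  · obtain ⟨e⟩ := nonempty_biproduct_iso_sumFunctor F deg J
    exact ⟨fun ⟨f⟩ => ⟨f ≪≫ e⟩, fun ⟨f⟩ => ⟨f ≪≫ e.symm⟩⟩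
  · exact funext_iff.symm

/-! ### Coordinates in direct sums of interval functors -/

open scoped Classical in
/-- The coordinate of index `i` of an element of a term of `sumFunctor`; it is `0` if the summand
of index `i` vanishes there. -/
noncomputable def coord (r : ℝ≥0) (k : ℕ) (i : ι) : SumTerm F deg J r k →ₗ[F] F where
  toFun f := if h : Alive (deg i) (J i) r k then f i ⟨h⟩ else 0
  map_add' f g := by split_ifs <;> simp
  map_smul' c f := by split_ifs <;> simp

theorem coord_of_alive {r : ℝ≥0} {k : ℕ} {i : ι} (h : Alive (deg i) (J i) r k)
    (f : SumTerm F deg J r k) : coord r k i f = f i ⟨h⟩ := dif_pos h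

theorem coord_of_not_alive {r : ℝ≥0} {k : ℕ} {i : ι} (h : ¬ Alive (deg i) (J i) r k)
    (f : SumTerm F deg J r k) : coord r k i f = 0 := dif_neg h

open scoped Classical in
variable (F deg J) in
/-- The standard generator of index `i` of a term of `sumFunctor`; it is `0` if the summand of
index `i` vanishes there. -/
noncomputable def gen (r : ℝ≥0) (k : ℕ) (i : ι) : SumTerm F deg J r k :=
  fun i' _ => if i' = i then 1 else 0

theorem gen_eq_zero {r : ℝ≥0} {k : ℕ} {i : ι} (h : ¬ Alive (deg i) (J i) r k) :
    gen F deg J r k i = 0 := by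
  funext i' p
  refine if_neg ?_
  rintro rfl
  exact h p.down

theorem sum_coord_smul_gen [Fintype ι] {r : ℝ≥0} {k : ℕ} (f : SumTerm F deg J r k) :
    ∑ i, coord r k i f • gen F deg J r k i = f := by
  classical
  funext i p
  rw [Finset.sum_apply, Finset.sum_apply, Finset.sum_eq_single i]
  · simp [gen, coord_of_alive p.down]
  · intro i' _ h
    simp [gen, h.symm]
  · simp

theorem sumMap_gen {q r : ℝ≥0} (h : q ≤ r) (k : ℕ) (i : ι) :
    sumMap F deg J h k (gen F deg J q k i) = gen F deg J r k i := rfl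

theorem coord_sumMap {q r : ℝ≥0} (h : q ≤ r) {k : ℕ} {i : ι} (hi : Alive (deg i) (J i) r k)
    (f : SumTerm F deg J q k) : coord r k i (sumMap F deg J h k f) = coord q k i f := by
  rw [coord_of_alive hi, coord_of_alive (hi.mono h)]
  rfl

theorem sumD_gen {r : ℝ≥0} {k : ℕ} {i : ι} (hi : deg i = k + 1) :
    sumD F deg J r (k + 1) k (gen F deg J r (k + 1) i) = gen F deg J r k i := by
  classical
  funext i' p
  change (if h : k + 1 = k + 1 ∧ k + 1 = deg i' ∧ (r : ℝ≥0∞) < (J i').right then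
    (if i' = i then (1 : F) else 0) else 0) = if i' = i then 1 else 0
  by_cases h : i' = i
  · subst h
    refine dif_pos ⟨rfl, hi.symm, ?_⟩
    rcases p.down with h | h
    · exact h.2
    · exact h.2.trans_le (J i').tag_le
  · simp [h]

theorem coord_sumD_of_deg_eq {r : ℝ≥0} {k : ℕ} {i : ι} (hi : deg i = k)
    (f : SumTerm F deg J r (k + 1)) : coord r k i (sumD F deg J r (k + 1) k f) = 0 := by
  by_cases h : Alive (deg i) (J i) r k
  · rw [coord_of_alive h]
    exact dif_neg fun h => by omega
  · exact coord_of_not_alive h _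

theorem coord_sumD_of_deg_eq_succ {r : ℝ≥0} {k : ℕ} {i : ι} (hi : deg i = k + 1)
    (hr : (r : ℝ≥0∞) < (J i).tag) (f : SumTerm F deg J r (k + 1)) :
    coord r k i (sumD F deg J r (k + 1) k f) = coord r (k + 1) i f := by
  rw [coord_of_alive (Or.inr ⟨hi.symm, hr⟩),
    coord_of_alive (Or.inl ⟨hi.symm, hr.trans_le (J i).tag_le⟩)]
  exact dif_pos ⟨rfl, hi.symm, hr.trans_le (J i).tag_le⟩

theorem naturality_apply {X Y : ParamChain F} (φ : X ⟶ Y) {q r : ℝ≥0} (a : q ⟶ r) (k : ℕ)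
    (x : (X.obj q).X k) : ((φ.app r).f k).hom (((X.map a).f k).hom x) =
      ((Y.map a).f k).hom (((φ.app q).f k).hom x) :=
  LinearMap.congr_fun (ModuleCat.hom_ext_iff.1
    (HomologicalComplex.congr_hom (φ.naturality a) k)) x

theorem comm_apply {C D : ChainComplex (ModuleCat.{u} F) ℕ} (f : C ⟶ D) (k l : ℕ) (x : C.X k) :
    (f.f l).hom ((C.d k l).hom x) = (D.d k l).hom ((f.f k).hom x) :=
  (LinearMap.congr_fun (ModuleCat.hom_ext_iff.1 (f.comm k l)) x).symm

/-! ### From interleavings to matchings -/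

variable {κ : Type} {deg' : κ → ℕ} {J' : κ → TaggedInterval} {ε : ℝ≥0}

/-- The components of a map from `sumFunctor` to a shifted `sumFunctor`, as linear maps. -/
noncomputable def comp (φ : sumFunctor F deg J ⟶ shift ε (sumFunctor F deg' J')) (r : ℝ≥0)
    (k : ℕ) : SumTerm F deg J r k →ₗ[F] SumTerm F deg' J' (r + ε) k :=
  ((φ.app r).f k).hom

theorem comp_sumMap (φ : sumFunctor F deg J ⟶ shift ε (sumFunctor F deg' J')) {q r : ℝ≥0}
    (h : q ≤ r) (k : ℕ) (f : SumTerm F deg J q k) :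
    comp φ r k (sumMap F deg J h k f) =
      sumMap F deg' J' (add_le_add_left h ε) k (comp φ q k f) :=
  naturality_apply φ (homOfLE h) k f

theorem comp_sumD (φ : sumFunctor F deg J ⟶ shift ε (sumFunctor F deg' J')) (r : ℝ≥0)
    (k l : ℕ) (f : SumTerm F deg J r k) :
    comp φ r l (sumD F deg J r k l f) = sumD F deg' J' (r + ε) k l (comp φ r k f) :=
  comm_apply (φ.app r) k l f

/-- The matrix coefficient in degree `k` of a map between direct sums of interval functors. -/
noncomputable def coeff (φ : sumFunctor F deg J ⟶ shift ε (sumFunctor F deg' J')) (k : ℕ) (j : κ)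
    (i : ι) : F :=
  coord (0 + ε) k j (comp φ 0 k (gen F deg J 0 k i))

theorem coeff_eq_coord (φ : sumFunctor F deg J ⟶ shift ε (sumFunctor F deg' J')) {k : ℕ} {j : κ}
    (i : ι) {r : ℝ≥0} (h : Alive (deg' j) (J' j) (r + ε) k) :
    coeff φ k j i = coord (r + ε) k j (comp φ r k (gen F deg J r k i)) := by
  rw [← sumMap_gen (zero_le : 0 ≤ r), comp_sumMap, coord_sumMap _ h, coeff]

/-- The image of a generator vanishes `ε` after the generator at the latest. -/
theorem right_le_of_coeff_ne_zero (φ : sumFunctor F deg J ⟶ shift ε (sumFunctor F deg' J'))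
    {j : κ} {i : ι} (hij : deg' j = deg i) (h : coeff φ (deg i) j i ≠ 0) :
    (J' j).right ≤ (J i).right + ε := by
  by_contra! hlt
  refine h ?_
  have hi : (J i).right ≠ ∞ := by
    intro h
    simp [h] at hlt
  lift (J i).right to ℝ≥0 using hi with r hr
  have hz : gen F deg J r (deg i) i = 0 := gen_eq_zero (by simp [Alive, ← hr])
  rw [coeff_eq_coord φ i (r := r) (Or.inl ⟨hij.symm, by exact_mod_cast hlt⟩), hz, map_zero,
    map_zero]

/-- The boundary of the image of a generator vanishes `ε` after the boundary of the generator at the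
latest. -/
theorem tag_le_of_coeff_ne_zero (φ : sumFunctor F deg J ⟶ shift ε (sumFunctor F deg' J'))
    (hdeg' : ∀ j, deg' j = 0 → (J' j).tag = 0)
    {j : κ} {i : ι} (hij : deg' j = deg i) (h : coeff φ (deg i) j i ≠ 0) :
    (J' j).tag ≤ (J i).tag + ε := by
  by_contra! hlt
  refine h ?_
  obtain ⟨k, hk⟩ : ∃ k, deg i = k + 1 := by
    refine Nat.exists_eq_succ_of_ne_zero fun h0 => ?_
    rw [hdeg' j (hij.trans h0)] at hlt
    exact not_lt_zero hlt
  have hi : (J i).tag ≠ ∞ := by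
    intro h
    simp [h] at hlt
  lift (J i).tag to ℝ≥0 using hi with r hr
  have hlt' : ((r + ε : ℝ≥0) : ℝ≥0∞) < (J' j).tag := by exact_mod_cast hlt
  have hz : gen F deg J r k i = 0 := gen_eq_zero (by simp [Alive, ← hr, hk])
  rw [hk, coeff_eq_coord φ i (r := r)
    (Or.inl ⟨(hij.trans hk).symm, hlt'.trans_le (J' j).tag_le⟩),
    ← coord_sumD_of_deg_eq_succ (hij.trans hk) hlt', ← comp_sumD, sumD_gen hk, hz, map_zero,
    map_zero]

/-- The matrices of an interleaving multiply to the identity on the tagged intervals that are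
longer than `2ε`. Only the summands of the same degree contribute: in degree `n` the generators
of summands of degree `n + 1` are boundaries, on which the coordinates of summands of degree `n`
vanish. -/
theorem sum_coeff_mul_coeff [Fintype κ] [DecidableEq ι]
    (φ : sumFunctor F deg J ⟶ shift ε (sumFunctor F deg' J'))
    (ψ : sumFunctor F deg' J' ⟶ shift ε (sumFunctor F deg J))
    (h : ∀ t : ℝ≥0, φ.app t ≫ ψ.app (t + ε) =
      (sumFunctor F deg J).map (homOfLE (le_add_right le_self_add : t ≤ t + ε + ε)))
    {i i' : ι} (hi' : ((ε + ε : ℝ≥0) : ℝ≥0∞) < (J i').right) :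
    ∑ j, (if deg i' = deg' j then coeff ψ (deg' j) i' j else 0) *
      (if deg' j = deg i then coeff φ (deg i) j i else 0) = if i' = i then 1 else 0 := by
  by_cases hd : deg i' = deg i
  swap
  · rw [if_neg (fun h => hd (congrArg deg h))]
    refine Finset.sum_eq_zero fun j _ => ?_
    by_cases h1 : deg i' = deg' j
    · rw [if_neg (c := deg' j = deg i) (fun h2 => hd (h1.trans h2)), mul_zero]
    · rw [if_neg h1, zero_mul]
  have halive : Alive (deg i') (J i') (0 + ε + ε) (deg i) :=
    Or.inl ⟨hd.symm, by rwa [zero_add]⟩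
  have h1 : comp ψ (0 + ε) (deg i) (comp φ 0 (deg i) (gen F deg J 0 (deg i) i)) =
      gen F deg J (0 + ε + ε) (deg i) i :=
    LinearMap.congr_fun (ModuleCat.hom_ext_iff.1
      (HomologicalComplex.congr_hom (h 0) (deg i))) (gen F deg J 0 (deg i) i)
  have h2 := congrArg (coord (0 + ε + ε) (deg i) i') h1
  rw [coord_of_alive halive (gen F deg J (0 + ε + ε) (deg i) i),
    ← sum_coord_smul_gen (comp φ 0 (deg i) _), map_sum, map_sum] at h2
  have h3 : gen F deg J (0 + ε + ε) (deg i) i i' ⟨halive⟩ = if i' = i then 1 else 0 := by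
    simp [gen]
  rw [← h3, ← h2]
  refine Finset.sum_congr rfl fun j _ => ?_
  rw [map_smul, map_smul, smul_eq_mul, ← coeff_eq_coord ψ j halive, ← coeff]
  by_cases hj : deg' j = deg i
  · rw [if_pos (hd.trans hj.symm), if_pos hj, hj, mul_comm]
  rw [if_neg hj, mul_zero]
  symm
  by_cases hj' : Alive (deg' j) (J' j) (0 + ε) (deg i)
  swap
  · rw [coeff, coord_of_not_alive hj', zero_mul]
  obtain hj' | hj' := hj'
  · exact absurd hj'.1.symm hj
  have hψ : coeff ψ (deg i) i' j = 0 := by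
    rw [coeff, ← sumD_gen hj'.1.symm, comp_sumD, coord_sumD_of_deg_eq hd]
  rw [hψ, mul_zero]

/-- Algebraic stability for direct sums of interval functors. -/
theorem Interleaved.exists_isFamilyMatching [Fintype ι] [Fintype κ]
    (hdeg : ∀ i, deg i = 0 → (J i).tag = 0) (hdeg' : ∀ j, deg' j = 0 → (J' j).tag = 0)
    (h : Interleaved ε (sumFunctor F deg J) (sumFunctor F deg' J')) :
    ∃ R : ι → κ → Prop, IsFamilyMatching ε deg J deg' J' R := by
  classical
  obtain ⟨φ, ψ, h1, h2⟩ := h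
  refine exists_isFamilyMatching_of_matrices ε deg J deg' J'
    (fun j i => if deg' j = deg i then coeff φ (deg i) j i else 0)
    (fun i j => if deg i = deg' j then coeff ψ (deg' j) i j else 0) ?_ ?_
    (fun i i' hi' => sum_coeff_mul_coeff φ ψ h1 hi')
    (fun j j' hj' => sum_coeff_mul_coeff ψ φ h2 hj')
  · intro j i hij
    rw [ite_ne_right_iff] at hij
    exact ⟨hij.1.symm, tag_le_of_coeff_ne_zero φ hdeg' hij.1 hij.2,
      right_le_of_coeff_ne_zero φ hij.1 hij.2⟩
  · intro i j hij
    rw [ite_ne_right_iff] at hij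
    exact ⟨hij.1.symm, tag_le_of_coeff_ne_zero ψ hdeg hij.1 hij.2,
      right_le_of_coeff_ne_zero ψ hij.1 hij.2⟩

end SumFunctor

/-! ### From matchings to interleavings -/

section MatchingToInterleaving

universe u

variable {F : Type u} [Field F] {ι κ : Type} {deg : ι → ℕ} {J : ι → TaggedInterval}
  {deg' : κ → ℕ} {J' : κ → TaggedInterval} {ε : ℝ≥0} {R : ι → κ → Prop}

theorem IsFamilyMatching.alive (h : IsFamilyMatching ε deg J deg' J' R) {i : ι} {j : κ}
    (hij : R i j) {r : ℝ≥0} {k : ℕ} (hj : Alive (deg' j) (J' j) (r + ε) k) :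
    Alive (deg i) (J i) r k := by
  have hc := TaggedInterval.cost_le_iff.1 (h.cost_le i j hij)
  rw [Alive, h.deg_eq i j hij]
  refine hj.imp (fun hj => ⟨hj.1, ?_⟩) (fun hj => ⟨hj.1, ?_⟩)
  · have := hj.2.trans_le hc.2.2
    rw [ENNReal.coe_add] at this
    exact lt_of_add_lt_add_right this
  · have := hj.2.trans_le hc.1.2
    rw [ENNReal.coe_add] at this
    exact lt_of_add_lt_add_right this

open scoped Classical in
/-- The map between terms of direct sums of interval functors that is the canonical map on matched
summands and zero between unmatched ones. -/
noncomputable def matchingMap (h : IsFamilyMatching ε deg J deg' J' R) (r : ℝ≥0) (k : ℕ) :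
    SumTerm F deg J r k →ₗ[F] SumTerm F deg' J' (r + ε) k where
  toFun f j p := if hj : ∃ i, R i j then f hj.choose ⟨h.alive hj.choose_spec p.down⟩ else 0
  map_add' f g := by
    funext j p
    by_cases hj : ∃ i, R i j <;> simp [hj]
  map_smul' c f := by
    funext j p
    by_cases hj : ∃ i, R i j <;> simp [hj]

theorem matchingMap_apply (h : IsFamilyMatching ε deg J deg' J' R) {r : ℝ≥0} {k : ℕ}
    (f : SumTerm F deg J r k) {i : ι} {j : κ} (hij : R i j)
    (p : PLift (Alive (deg' j) (J' j) (r + ε) k)) :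
    matchingMap h r k f j p = f i ⟨h.alive hij p.down⟩ := by
  have hj : ∃ i, R i j := ⟨i, hij⟩
  have hi := h.left_unique _ _ _ hij hj.choose_spec
  subst hi
  exact dif_pos hj

theorem matchingMap_apply_of_forall_not (h : IsFamilyMatching ε deg J deg' J' R) {r : ℝ≥0} {k : ℕ}
    (f : SumTerm F deg J r k) {j : κ} (hj : ∀ i, ¬ R i j)
    (p : PLift (Alive (deg' j) (J' j) (r + ε) k)) :
    matchingMap h r k f j p = 0 :=
  dif_neg (not_exists.2 hj)

theorem matchingMap_sumD (h : IsFamilyMatching ε deg J deg' J' R) (r : ℝ≥0) (k l : ℕ)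
    (f : SumTerm F deg J r k) :
    matchingMap h r l (sumD F deg J r k l f) =
      sumD F deg' J' (r + ε) k l (matchingMap h r k f) := by
  funext j p
  have hr' : ((r + ε : ℝ≥0) : ℝ≥0∞) < (J' j).right := by
    rcases p.down with p | p
    · exact p.2
    · exact p.2.trans_le (J' j).tag_le
  by_cases hj : ∃ i, R i j
  · obtain ⟨i, hij⟩ := hj
    rw [matchingMap_apply h _ hij]
    have hr : (r : ℝ≥0∞) < (J i).right := by
      rcases h.alive hij p.down with p | p
      · exact p.2
      · exact p.2.trans_le (J i).tag_le
    change (if hd : l + 1 = k ∧ k = deg i ∧ (r : ℝ≥0∞) < (J i).right then f i ⟨Or.inl hd.2⟩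
      else 0) = if hd : l + 1 = k ∧ k = deg' j ∧ ((r + ε : ℝ≥0) : ℝ≥0∞) < (J' j).right then
        matchingMap h r k f j ⟨Or.inl hd.2⟩ else 0
    have hd := h.deg_eq i j hij
    by_cases hk : l + 1 = k ∧ k = deg i
    · rw [dif_pos ⟨hk.1, hk.2, hr⟩, dif_pos ⟨hk.1, hk.2.trans hd, hr'⟩, matchingMap_apply h _ hij]
    · rw [dif_neg fun hk' => hk ⟨hk'.1, hk'.2.1⟩, dif_neg fun hk' => hk ⟨hk'.1, hd ▸ hk'.2.1⟩]
  · push Not at hj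
    rw [matchingMap_apply_of_forall_not h _ hj]
    symm
    change (if hd : l + 1 = k ∧ k = deg' j ∧ ((r + ε : ℝ≥0) : ℝ≥0∞) < (J' j).right then
        matchingMap h r k f j ⟨Or.inl hd.2⟩ else 0) = 0
    split_ifs with hd
    · exact matchingMap_apply_of_forall_not h _ hj _
    · rfl

theorem matchingMap_matchingMap (h : IsFamilyMatching ε deg J deg' J' R) (r : ℝ≥0) (k : ℕ)
    (f : SumTerm F deg J r k) : matchingMap h.symm (r + ε) k (matchingMap h r k f) =
      sumMap F deg J (le_add_right le_self_add) k f := by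
  funext i p
  by_cases hi : ∃ j, R i j
  · obtain ⟨j, hij⟩ := hi
    rw [matchingMap_apply h.symm _ hij, matchingMap_apply h _ hij]
    rfl
  · push Not at hi
    exfalso
    have h1 := h.left_le i hi
    have h2 : ((r + ε + ε : ℝ≥0) : ℝ≥0∞) < (J i).right := by
      rcases p.down with p | p
      · exact p.2
      · exact p.2.trans_le (J i).tag_le
    have h3 := h2.trans_le h1
    norm_cast at h3
    rw [add_assoc] at h3
    exact h3.not_ge le_add_self

theorem matchingMap_sumMap (h : IsFamilyMatching ε deg J deg' J' R) {q r : ℝ≥0} (hqr : q ≤ r)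
    (k : ℕ) (f : SumTerm F deg J q k) : matchingMap h r k (sumMap F deg J hqr k f) =
      sumMap F deg' J' (add_le_add_left hqr ε) k (matchingMap h q k f) := by
  funext j p
  change _ = matchingMap h q k f j ⟨p.down.mono (add_le_add_left hqr ε)⟩
  by_cases hj : ∃ i, R i j
  · obtain ⟨i, hij⟩ := hj
    rw [matchingMap_apply h _ hij, matchingMap_apply h _ hij]
    rfl
  · push Not at hj
    rw [matchingMap_apply_of_forall_not h _ hj, matchingMap_apply_of_forall_not h _ hj]

/-- The map from a direct sum of interval functors to the shift of another one that is induced by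
a matching. -/
noncomputable def matchingHom (h : IsFamilyMatching ε deg J deg' J' R) :
    sumFunctor F deg J ⟶ shift ε (sumFunctor F deg' J') where
  app r :=
    { f := fun k => ModuleCat.ofHom (matchingMap h r k)
      comm' := fun k l _ => ModuleCat.hom_ext <| LinearMap.ext fun f =>
        (matchingMap_sumD h r k l f).symm }
  naturality q r a := by
    refine HomologicalComplex.hom_ext _ _ fun k => ModuleCat.hom_ext <| LinearMap.ext fun f =>
      funext fun j => funext fun p => ?_
    exact congrFun (congrFun (matchingMap_sumMap h (leOfHom a) k f) j) p

theorem IsFamilyMatching.interleaved (h : IsFamilyMatching ε deg J deg' J' R) :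
    Interleaved ε (sumFunctor F deg J) (sumFunctor F deg' J') := by
  refine ⟨matchingHom h, matchingHom h.symm, fun t => ?_, fun t => ?_⟩
  · exact HomologicalComplex.hom_ext _ _ fun k => ModuleCat.hom_ext <| LinearMap.ext fun f =>
      matchingMap_matchingMap h t k f
  · exact HomologicalComplex.hom_ext _ _ fun k => ModuleCat.hom_ext <| LinearMap.ext fun f =>
      matchingMap_matchingMap h.symm t k f

end MatchingToInterleaving

theorem Interleaved.of_iso {C : Type*} [Category* C] {X X' Y Y' : ℝ≥0 ⥤ C} {ε : ℝ≥0}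
    (e : X ≅ X') (e' : Y ≅ Y') (h : Interleaved ε X Y) : Interleaved ε X' Y' := by
  obtain ⟨φ, ψ, h1, h2⟩ := h
  have aux : ∀ {A A' B B' D D' : C} (i : A' ⟶ A) (f : A ⟶ B) (k : B ⟶ B') (k' : B' ⟶ B)
      (g : B ⟶ D) (m : D ⟶ D') (f' : A ⟶ D) (_ : k ≫ k' = 𝟙 _) (_ : f ≫ g = f'),
      (i ≫ f ≫ k) ≫ k' ≫ g ≫ m = i ≫ f' ≫ m := by
    rintro A A' B B' D D' i f k k' g m f' h3 rfl
    simp [reassoc_of% h3]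
  refine ⟨e.inv ≫ φ ≫ Functor.whiskerLeft (translate ε) e'.hom,
    e'.inv ≫ ψ ≫ Functor.whiskerLeft (translate ε) e.hom, fun t => ?_, fun t => ?_⟩
  · refine (aux (e.inv.app t) (φ.app t) (e'.hom.app (t + ε)) (e'.inv.app (t + ε)) (ψ.app (t + ε))
      (e.hom.app (t + ε + ε)) _ (e'.hom_inv_id_app _) (h1 t)).trans ?_
    exact NatIso.naturality_1 e _
  · refine (aux (e'.inv.app t) (ψ.app t) (e.hom.app (t + ε)) (e.inv.app (t + ε)) (φ.app (t + ε))
      (e'.hom.app (t + ε + ε)) _ (e.hom_inv_id_app _) (h2 t)).trans ?_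
    exact NatIso.naturality_1 e' _

theorem interleaved_self {C : Type*} [Category* C] (X : ℝ≥0 ⥤ C) (ε : ℝ≥0) :
    Interleaved ε X X := by
  let φ : X ⟶ shift ε X :=
    { app := fun t => X.map (homOfLE le_self_add)
      naturality := fun s t a => (X.map_comp _ _).symm.trans
        (X.map_comp (homOfLE le_self_add) ((translate ε).map a)) }
  exact ⟨φ, φ, fun t => (X.map_comp (homOfLE le_self_add) (homOfLE le_self_add)).symm,
    fun t => (X.map_comp (homOfLE le_self_add) (homOfLE le_self_add)).symm⟩

/-! ### Death times in factored chain complexes -/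

section Existence

universe u

variable {F : Type u} [Field F] (X : ParamChain F)

/-- The elements of degree `k` of `X^0` that vanish in `X^t`. -/
noncomputable def vanishing (t : ℝ≥0) (k : ℕ) : Submodule F ((X.obj 0).X k) :=
  LinearMap.ker ((X.map (homOfLE (zero_le : 0 ≤ t))).f k).hom

variable {X}

theorem mem_vanishing {t : ℝ≥0} {k : ℕ} {v : (X.obj 0).X k} :
    v ∈ vanishing X t k ↔ ((X.map (homOfLE (zero_le : 0 ≤ t))).f k).hom v = 0 := Iff.rfl

theorem map_map_apply {q r : ℝ≥0} (h : q ≤ r) (k : ℕ) (v : (X.obj 0).X k) :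
    ((X.map (homOfLE h)).f k).hom (((X.map (homOfLE (zero_le : 0 ≤ q))).f k).hom v) =
      ((X.map (homOfLE (zero_le : 0 ≤ r))).f k).hom v := by
  have := X.map_comp (homOfLE (zero_le : 0 ≤ q)) (homOfLE h)
  exact (LinearMap.congr_fun (ModuleCat.hom_ext_iff.1 (HomologicalComplex.congr_hom this k)) v).symm

theorem vanishing_mono (k : ℕ) : Monotone fun t => vanishing X t k := by
  intro q r h v hv
  rw [mem_vanishing] at hv ⊢
  rw [← map_map_apply h, hv, map_zero]

theorem vanishing_zero (k : ℕ) : vanishing X 0 k = ⊥ := by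
  refine (Submodule.eq_bot_iff _).2 fun v hv => ?_
  have := X.map_id 0
  exact (LinearMap.congr_fun (ModuleCat.hom_ext_iff.1 (HomologicalComplex.congr_hom this k))
    v).symm.trans hv

theorem d_mem_vanishing {t : ℝ≥0} {k : ℕ} (l : ℕ) {v : (X.obj 0).X k}
    (hv : v ∈ vanishing X t k) : ((X.obj 0).d k l).hom v ∈ vanishing X t l := by
  rw [mem_vanishing] at hv ⊢
  rw [comm_apply, hv, map_zero]

theorem map_surjective (hX : Epimorphic X) (r : ℝ≥0) (k : ℕ) :
    Function.Surjective ((X.map (homOfLE (zero_le : 0 ≤ r))).f k).hom := by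
  have := hX 0 r zero_le
  exact (ModuleCat.epi_iff_surjective _).1 inferInstance

variable (X) in
/-- The first parameter at which an element of `X^0` vanishes. -/
noncomputable def death (k : ℕ) (v : (X.obj 0).X k) : ℝ≥0∞ :=
  ⨅ (t : ℝ≥0) (_ : v ∈ vanishing X t k), (t : ℝ≥0∞)

/-- By tameness on the right, the infimum defining the death time is attained if it is finite. -/
theorem death_le_iff (hX : Tame X) {k : ℕ} {v : (X.obj 0).X k} {r : ℝ≥0} :
    death X k v ≤ r ↔ v ∈ vanishing X r k := by
  refine ⟨fun h => ?_, fun h => iInf₂_le r h⟩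
  obtain ⟨ε, hε, hiso⟩ := hX.1 r
  have hlt : death X k v < ((r + ε : ℝ≥0) : ℝ≥0∞) :=
    h.trans_lt (ENNReal.coe_lt_coe.2 (lt_add_of_pos_right r hε))
  obtain ⟨t, ht⟩ := iInf_lt_iff.1 hlt
  obtain ⟨hv, ht⟩ := iInf_lt_iff.1 ht
  have hv' := vanishing_mono k (ENNReal.coe_lt_coe.1 ht).le hv
  have := hiso ε le_rfl
  have hinj : Function.Injective ((X.map (homOfLE (le_self_add : r ≤ r + ε))).f k).hom :=
    (ModuleCat.mono_iff_injective _).1 inferInstance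
  rw [mem_vanishing] at hv' ⊢
  rw [← map_map_apply le_self_add] at hv'
  exact hinj (hv'.trans (map_zero _).symm)

theorem lt_death_iff (hX : Tame X) {k : ℕ} {v : (X.obj 0).X k} {r : ℝ≥0} :
    r < death X k v ↔ v ∉ vanishing X r k := by
  rw [← death_le_iff hX, not_le]

/-! ### Isomorphisms from generators -/

/-- Generators of `X^0`, together with their boundaries, induce an isomorphism from a direct sum of
interval functors to `X` if they span `X^0` and if a linear combination vanishes in `X^r` only if
its coefficients at the summands that are nonzero at `r` are zero. The generator of index `i` is
encoded as the family `x i` of elements of all degrees that is zero outside of degree `deg i`. -/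
theorem nonempty_iso_sumFunctor_of_generators (hX : Epimorphic X) {ι : Type} [Fintype ι]
    {deg : ι → ℕ} {J : ι → TaggedInterval} (x : ι → ∀ k, (X.obj 0).X k)
    (hx : ∀ i k, k ≠ deg i → x i k = 0)
    (y : ι → ∀ k, (X.obj 0).X k)
    (hy : ∀ i k, y i k = x i k + ((X.obj 0).d (k + 1) k).hom (x i (k + 1)))
    (hdead : ∀ i r k, ¬ Alive (deg i) (J i) r k → y i k ∈ vanishing X r k)
    (hinj : ∀ (r : ℝ≥0) (k : ℕ) (c : ι → F), ∑ i, c i • y i k ∈ vanishing X r k →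
      ∀ i, Alive (deg i) (J i) r k → c i = 0)
    (hspan : ∀ k, Submodule.span F (Set.range fun i => y i k) = ⊤) :
    Nonempty (X ≅ sumFunctor F deg J) := by
  let m (r : ℝ≥0) (k : ℕ) : (X.obj 0).X k →ₗ[F] (X.obj r).X k :=
    ((X.map (homOfLE (zero_le : 0 ≤ r))).f k).hom
  let Θ (r : ℝ≥0) (k : ℕ) : SumTerm F deg J r k →ₗ[F] (X.obj r).X k :=
    ∑ i, (coord r k i).smulRight (m r k (y i k))
  have hΘ : ∀ r k f, Θ r k f = ∑ i, coord r k i f • m r k (y i k) := fun r k f => by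
    simp [Θ]
  have hΘ' : ∀ r k f, Θ r k f = m r k (∑ i, coord r k i f • y i k) := fun r k f => by
    rw [hΘ, map_sum]
    simp only [map_smul]
  have hd : ∀ r k l f, l + 1 = k → ((X.obj r).d k l).hom (Θ r k f) =
      Θ r l (sumD F deg J r k l f) := by
    rintro r k l f rfl
    rw [hΘ, hΘ, map_sum]
    refine Finset.sum_congr rfl fun i _ => ?_
    rw [map_smul, ← comm_apply]
    have h1 : ((X.obj 0).d (l + 1) l).hom (y i (l + 1)) =
        ((X.obj 0).d (l + 1) l).hom (x i (l + 1)) := by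
      have h2 := LinearMap.congr_fun (ModuleCat.hom_ext_iff.1
        ((X.obj 0).d_comp_d (l + 1 + 1) (l + 1) l)) (x i (l + 1 + 1))
      rw [hy, map_add]
      exact (congrArg _ h2).trans (add_zero _)
    rw [h1]
    by_cases hi : deg i = l + 1
    · have h2 : y i l = ((X.obj 0).d (l + 1) l).hom (x i (l + 1)) := by
        rw [hy, hx i l (by omega), zero_add]
      rw [h2]
      by_cases hr : (r : ℝ≥0∞) < (J i).tag
      · rw [coord_sumD_of_deg_eq_succ hi hr]
      · have h3 : m r l (((X.obj 0).d (l + 1) l).hom (x i (l + 1))) = 0 := by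
          rw [← h2]
          refine hdead i r l ?_
          rintro (h | h)
          · omega
          · exact hr h.2
        exact (congrArg _ h3).trans ((smul_zero _).trans
          ((congrArg _ h3).trans (smul_zero _)).symm)
    · rw [hx i (l + 1) (Ne.symm hi), map_zero, map_zero, smul_zero]
      by_cases hi' : deg i = l
      · rw [coord_sumD_of_deg_eq hi', zero_smul]
      · rw [hy, hx i l (Ne.symm hi'), hx i (l + 1) (Ne.symm hi), map_zero, add_zero, map_zero,
          smul_zero]
  have hmap : ∀ {q r : ℝ≥0} (h : q ≤ r) k f, Θ r k (sumMap F deg J h k f) =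
      ((X.map (homOfLE h)).f k).hom (Θ q k f) := by
    intro q r hqr k f
    rw [hΘ, hΘ, map_sum]
    refine Finset.sum_congr rfl fun i _ => ?_
    have h1 : ((X.map (homOfLE hqr)).f k).hom (m q k (y i k)) = m r k (y i k) :=
      map_map_apply hqr k _
    rw [map_smul, h1]
    by_cases h : Alive (deg i) (J i) r k
    · rw [coord_sumMap _ h]
    · have h2 : m r k (y i k) = 0 := hdead i r k h
      rw [h2, smul_zero, smul_zero]
  let Ψ : sumFunctor F deg J ⟶ X :=
    { app := fun r =>
        { f := fun k => ModuleCat.ofHom (Θ r k)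
          comm' := fun k l h => ModuleCat.hom_ext <| LinearMap.ext fun f => hd r k l f h }
      naturality := fun q r a => by
        exact HomologicalComplex.hom_ext _ _ fun k => ModuleCat.hom_ext <|
          LinearMap.ext fun f => hmap (leOfHom a) k f }
  have hbij : ∀ r k, Function.Bijective (Θ r k) := by
    intro r k
    constructor
    · rw [← LinearMap.ker_eq_bot, LinearMap.ker_eq_bot']
      intro f hf
      rw [hΘ'] at hf
      funext i p
      rw [Pi.zero_apply, Pi.zero_apply, ← hinj r k _ hf i p.down, coord_of_alive p.down]
    · intro w
      obtain ⟨v, rfl⟩ := map_surjective hX r k w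
      obtain ⟨c, rfl⟩ := (Submodule.mem_span_range_iff_exists_fun F).1
        ((hspan k).ge (Submodule.mem_top (x := v)))
      refine ⟨fun i _ => c i, ?_⟩
      rw [hΘ]
      refine Eq.trans ?_ (map_sum _ _ _).symm
      refine Finset.sum_congr rfl fun i _ => ?_
      rw [map_smul]
      by_cases h : Alive (deg i) (J i) r k
      · rw [coord_of_alive h]
      · have h2 : m r k (y i k) = 0 := hdead i r k h
        exact (congrArg _ h2).trans ((smul_zero _).trans
          ((congrArg _ h2).trans (smul_zero _)).symm)
  have : ∀ r, IsIso (Ψ.app r) := fun r => by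
    have : ∀ k, IsIso ((Ψ.app r).f k) := fun k =>
      (ConcreteCategory.isIso_iff_bijective ((Ψ.app r).f k)).2 (hbij r k)
    exact HomologicalComplex.Hom.isIso_of_components _
  have := NatIso.isIso_of_isIso_app Ψ
  exact ⟨(asIso Ψ).symm⟩

/-! ### Decomposition into interval functors -/

/-- Two chains of subspaces, the second one containing `B`, admit a common adapted basis of a
complement of `B`. It is given together with the dual coordinate functionals, which vanish on all
members of the chains that do not contain the corresponding basis vector. -/
theorem exists_dual_pair {V : Type*} [AddCommGroup V] [Module F V] [FiniteDimensional F V]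
    (𝒦 ℒ : Set (Submodule F V)) (h𝒦 : IsChain (· ≤ ·) 𝒦) (hℒ : IsChain (· ≤ ·) ℒ)
    (B : Submodule F V) (hB : B ∈ ℒ) :
    ∃ (G : Set V) (l : V → V →ₗ[F] F), G.Finite ∧ Submodule.span F G ⊔ B = ⊤ ∧
      (∀ g ∈ G, l g g = 1) ∧ (∀ g ∈ G, ∀ g' ∈ G, g' ≠ g → l g g' = 0) ∧
      (∀ g ∈ G, ∀ v ∈ B, l g v = 0) ∧ (∀ g ∈ G, ∀ K ∈ 𝒦, g ∉ K → ∀ v ∈ K, l g v = 0) ∧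
      (∀ g ∈ G, ∀ L ∈ ℒ, g ∉ L → ∀ v ∈ L, l g v = 0) := by
  classical
  obtain ⟨E, hE, hEs, hEK, hEL⟩ := exists_adapted_basis 𝒦 ℒ h𝒦 hℒ ⊤
  let b : Module.Basis E F V := Module.Basis.mk hE (by
    have : Set.range (fun e : E => id e.1) = E := by simp
    rw [this, hEs])
  have hb : ∀ e : E, b e = e.1 := fun e => by simp [b]
  let l : V → V →ₗ[F] F := fun g => if hg : g ∈ E then b.coord ⟨g, hg⟩ else 0
  have hl1 : ∀ g ∈ E, l g g = 1 := by
    intro g hg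
    have h : b.coord ⟨g, hg⟩ (b ⟨g, hg⟩) = 1 := by simp
    rw [hb] at h
    simpa [l, hg] using h
  have hl0 : ∀ g ∈ E, ∀ g' ∈ E, g' ≠ g → l g g' = 0 := by
    intro g hg g' hg' hne
    have h : b.coord ⟨g, hg⟩ (b ⟨g', hg'⟩) = 0 := by
      rw [b.coord_apply, b.repr_self, Finsupp.single_eq_of_ne]
      exact fun h => hne (congrArg Subtype.val h).symm
    rw [hb] at h
    simpa [l, hg] using h
  have hN : ∀ N : Submodule F V, N ⊓ ⊤ ≤ Submodule.span F (E ∩ N) → ∀ g ∈ E, g ∉ N →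
      ∀ v ∈ N, l g v = 0 := by
    intro N hN g hg hgN v hv
    refine Submodule.span_induction (p := fun v _ => l g v = 0) ?_ (map_zero _) ?_ ?_
      (hN ⟨hv, Submodule.mem_top⟩)
    · exact fun e he => hl0 g hg e he.1 fun h => hgN (h ▸ he.2)
    · intro v w _ _ hv hw
      rw [map_add, hv, hw, add_zero]
    · intro c v _ hv
      rw [map_smul, hv, smul_zero]
  have hfin : E.Finite := by
    have := hE.setFinite
    exact this
  refine ⟨E \ B, l, hfin.subset Set.sdiff_subset, ?_, fun g hg => hl1 g hg.1,
    fun g hg g' hg' => hl0 g hg.1 g' hg'.1, fun g hg => hN B (hEL B hB) g hg.1 hg.2,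
    fun g hg K hK => hN K (hEK K hK) g hg.1, fun g hg L hL => hN L (hEL L hL) g hg.1⟩
  rw [eq_top_iff, ← hEs, Submodule.span_le]
  intro e he
  by_cases heB : e ∈ B
  · exact Submodule.mem_sup_right heB
  · exact Submodule.mem_sup_left (Submodule.subset_span ⟨he, heB⟩)

theorem death_d_le (k l : ℕ) (v : (X.obj 0).X k) :
    death X l (((X.obj 0).d k l).hom v) ≤ death X k v :=
  le_iInf₂ fun t ht => iInf₂_le t (d_mem_vanishing l ht)

/-- The structure theorem: every factored chain complex is a finite direct sum of interval
functors. In each degree, the generators are the vectors outside of the boundaries in a basis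
adapted both to the vanishing subspaces and to the boundaries and the preimages of the vanishing
subspaces under the differential. -/
theorem IsFactored.exists_iso_sumFunctor (hX : IsFactored X) :
    ∃ (m : ℕ) (deg : Fin m → ℕ) (J : Fin m → TaggedInterval),
      (∀ i, deg i = 0 → (J i).tag = 0) ∧ Nonempty (X ≅ sumFunctor F deg J) := by
  classical
  have hfd : ∀ k, FiniteDimensional F ((X.obj 0).X k) := (hX.compact 0).1
  have hdd : ∀ (k l m : ℕ) (v : (X.obj 0).X k),
      ((X.obj 0).d l m).hom (((X.obj 0).d k l).hom v) = 0 := fun k l m v =>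
    LinearMap.congr_fun (ModuleCat.hom_ext_iff.1 ((X.obj 0).d_comp_d k l m)) v
  let L (t : ℝ≥0) (k : ℕ) : Submodule F ((X.obj 0).X k) :=
    (vanishing X t (k - 1)).comap ((X.obj 0).d k (k - 1)).hom
  let B (k : ℕ) : Submodule F ((X.obj 0).X k) := LinearMap.range ((X.obj 0).d (k + 1) k).hom
  have hLmono : ∀ k, Monotone fun t => L t k := fun k q r h =>
    Submodule.comap_mono (vanishing_mono (k - 1) h)
  have hBL : ∀ k t, B k ≤ L t k := by
    rintro k t _ ⟨w, rfl⟩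
    change ((X.obj 0).d k (k - 1)).hom _ ∈ vanishing X t (k - 1)
    rw [hdd]
    exact Submodule.zero_mem _
  choose G l hfin hspan h1 h0 hB hK hL using fun k => exists_dual_pair
    (Set.range fun t => vanishing X t k) (insert (B k) (Set.range fun t => L t k))
    (vanishing_mono k).isChain_range
    ((hLmono k).isChain_range.insert (by
      rintro _ ⟨t, rfl⟩ -
      exact Or.inl (hBL k t))) (B k) (Set.mem_insert _ _)
  have hK := fun k g hg t => hK k g hg _ (Set.mem_range_self t)
  have hL := fun k g hg t => hL k g hg _ (Set.mem_insert_of_mem _ (Set.mem_range_self t))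
  have hG0 : ∀ k, ∀ g ∈ G k, g ≠ 0 := by
    rintro k g hg rfl
    have := h1 k 0 hg
    rw [map_zero] at this
    exact zero_ne_one this
  have hfinite : Finite (Σ k, G k) := by
    have : ∀ k, Finite (G k) := hfin
    have : Finite {k | Nontrivial ((X.obj 0).X k)} := (hX.compact 0).2
    refine Finite.of_injective (β := Σ k : {k | Nontrivial ((X.obj 0).X k)}, G k)
      (fun p => ⟨⟨p.1, ⟨p.2.1, 0, hG0 _ _ p.2.2⟩⟩, p.2⟩) ?_
    rintro ⟨k, g⟩ ⟨k', g'⟩ h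
    obtain ⟨h, h'⟩ := Sigma.mk.inj h
    obtain rfl : k = k' := congrArg Subtype.val h
    exact congrArg (Sigma.mk k) (eq_of_heq h')
  let e := (Finite.equivFin (Σ k, G k)).symm
  let Jp (p : Σ k, G k) : TaggedInterval :=
    { tag := death X (p.1 - 1) (((X.obj 0).d p.1 (p.1 - 1)).hom p.2.1)
      right := death X p.1 p.2.1
      right_pos := by
        have := (lt_death_iff hX.tame (r := 0) (v := p.2.1)).2 (by
          rw [vanishing_zero, Submodule.mem_bot]
          exact hG0 _ _ p.2.2)
        exact_mod_cast this
      tag_le := death_d_le _ _ _ }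
  let x (p : Σ k, G k) : ∀ k, (X.obj 0).X k :=
    Pi.single (M := fun k => (X.obj 0).X k) p.1 p.2.1
  have hxs : ∀ p, x p p.1 = p.2.1 := fun p => Pi.single_eq_same _ _
  have hxn : ∀ p k, k ≠ p.1 → x p k = 0 := fun p k h => Pi.single_eq_of_ne h _
  -- the coordinate functionals recover the coefficients of linear combinations of generators
  have hcoef : ∀ (c : Fin (Nat.card (Σ k, G k)) → F) i,
      l (e i).1 (e i).2.1 (∑ i', c i' • x (e i') (e i).1) = c i := by
    intro c i
    rw [map_sum, Finset.sum_eq_single i]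
    · rw [map_smul, hxs, h1 _ _ (e i).2.2, smul_eq_mul, mul_one]
    · intro i' _ hne
      have hne' : e i' ≠ e i := fun h => hne (e.injective h)
      rw [map_smul]
      have : l (e i).1 (e i).2.1 (x (e i') (e i).1) = 0 := by
        generalize e i' = p' at hne'
        generalize e i = p at hne'
        obtain ⟨k, g⟩ := p
        obtain ⟨k', g'⟩ := p'
        by_cases hk : k = k'
        · subst hk
          rw [hxs ⟨k, g'⟩]
          exact h0 k g.1 g.2 g'.1 g'.2 fun h => hne' (by rw [Subtype.ext h])
        · rw [hxn ⟨k', g'⟩ k hk, map_zero]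
      rw [this, smul_zero]
    · exact fun h => absurd (Finset.mem_univ _) h
  have hdeadx : ∀ p r k, ¬ Alive p.1 (Jp p) r k → x p k ∈ vanishing X r k := by
    rintro ⟨n, g⟩ r k h
    by_cases hk : k = n
    · subst hk
      rw [hxs ⟨k, g⟩]
      by_contra hg
      exact h (Or.inl ⟨rfl, (lt_death_iff hX.tame).2 hg⟩)
    · rw [hxn ⟨n, g⟩ k hk]
      exact Submodule.zero_mem _
  have hdeadd : ∀ p r k, ¬ Alive p.1 (Jp p) r k →
      ((X.obj 0).d (k + 1) k).hom (x p (k + 1)) ∈ vanishing X r k := by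
    rintro ⟨n, g⟩ r k h
    by_cases hk : k + 1 = n
    · subst hk
      rw [hxs ⟨k + 1, g⟩]
      by_contra hg
      exact h (Or.inr ⟨rfl, (lt_death_iff hX.tame).2 hg⟩)
    · rw [hxn ⟨n, g⟩ (k + 1) hk, map_zero]
      exact Submodule.zero_mem _
  have haliveK : ∀ (p : Σ k, G k) (r : ℝ≥0), (r : ℝ≥0∞) < (Jp p).right →
      p.2.1 ∉ vanishing X r p.1 := fun p r h => (lt_death_iff hX.tame).1 h
  have haliveL : ∀ (p : Σ k, G k) (r : ℝ≥0), (r : ℝ≥0∞) < (Jp p).tag →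
      p.2.1 ∉ L r p.1 := fun p r h => (lt_death_iff hX.tame).1 h
  have hcoefL : ∀ (c : Fin (Nat.card (Σ k, G k)) → F) i n r, n = (e i).1 →
      ∑ i', c i' • x (e i') n ∈ L r n → (r : ℝ≥0∞) < (Jp (e i)).tag → c i = 0 := by
    rintro c i n r rfl h hr
    rw [← hcoef c i]
    exact hL _ _ (e i).2.2 r (haliveL _ _ hr) _ h
  let y (i : Fin (Nat.card (Σ k, G k))) (k : ℕ) : (X.obj 0).X k :=
    x (e i) k + ((X.obj 0).d (k + 1) k).hom (x (e i) (k + 1))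
  refine ⟨Nat.card (Σ k, G k), fun i => (e i).1, fun i => Jp (e i), ?_,
    nonempty_iso_sumFunctor_of_generators hX.epimorphic (fun i => x (e i))
      (fun i k h => hxn _ _ h) y (fun _ _ => rfl) ?_ ?_ ?_⟩
  · intro i
    change (e i).1 = 0 → (Jp (e i)).tag = 0
    generalize e i = p
    obtain ⟨n, g⟩ := p
    rintro (rfl : n = 0)
    have hd : ((X.obj 0).d 0 (0 - 1)).hom g.1 = 0 :=
      LinearMap.congr_fun (ModuleCat.hom_ext_iff.1 ((X.obj 0).shape 0 (0 - 1) (by simp))) g.1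
    refine le_antisymm ((death_le_iff hX.tame (r := 0)).2 ?_) zero_le
    rw [hd]
    exact Submodule.zero_mem _
  · intro i r k h
    exact Submodule.add_mem _ (hdeadx _ _ _ h) (hdeadd _ _ _ h)
  · intro r k c hc
    have hsum : ∑ i, c i • y i k = ∑ i, c i • x (e i) k +
        ((X.obj 0).d (k + 1) k).hom (∑ i, c i • x (e i) (k + 1)) := by
      rw [map_sum, ← Finset.sum_add_distrib]
      exact Finset.sum_congr rfl fun i _ => by rw [map_smul, ← smul_add]
    rw [hsum] at hc
    -- generators of degree `k`: their coefficients can be read off modulo boundaries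
    have hstep : ∀ i, k = (e i).1 → (r : ℝ≥0∞) < (Jp (e i)).right → c i = 0 := by
      rintro i rfl hr
      have h2 := hK _ _ (e i).2.2 r (haliveK _ _ hr) _ hc
      rwa [map_add, hB _ _ (e i).2.2 _ ⟨_, rfl⟩, add_zero, hcoef] at h2
    have hZ : ∑ i, c i • x (e i) k ∈ vanishing X r k := by
      refine Submodule.sum_mem _ fun i _ => ?_
      by_cases hi : k = (e i).1
      · by_cases hr : (r : ℝ≥0∞) < (Jp (e i)).right
        · rw [hstep i hi hr, zero_smul]
          exact Submodule.zero_mem _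
        · refine Submodule.smul_mem _ _ (hdeadx _ _ _ ?_)
          rintro (h | h)
          · exact hr h.2
          · omega
      · rw [hxn _ _ hi, smul_zero]
        exact Submodule.zero_mem _
    -- what remains is a boundary of generators of degree `k + 1`
    have hdZ := (Submodule.add_mem_iff_right _ hZ).1 hc
    rintro i (⟨hi, hr⟩ | ⟨hi, hr⟩)
    · exact hstep i hi hr
    · exact hcoefL c i (k + 1) r hi hdZ hr
  · intro k
    have hxS : ∀ p, x p k ∈ Submodule.span F (Set.range fun i => y i k) := by
      intro p
      by_cases hp : k = p.1
      · refine Submodule.subset_span ⟨e.symm p, ?_⟩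
        change x (e (e.symm p)) k + _ = _
        rw [e.apply_symm_apply, hxn p (k + 1) (by omega), map_zero, add_zero]
      · rw [hxn p k hp]
        exact Submodule.zero_mem _
    have hdS : ∀ p, ((X.obj 0).d (k + 1) k).hom (x p (k + 1)) ∈
        Submodule.span F (Set.range fun i => y i k) := by
      intro p
      by_cases hp : k + 1 = p.1
      · refine Submodule.subset_span ⟨e.symm p, ?_⟩
        change x (e (e.symm p)) k + _ = _
        rw [e.apply_symm_apply, hxn p k (by omega), zero_add]
      · rw [hxn p (k + 1) hp, map_zero]
        exact Submodule.zero_mem _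
    rw [eq_top_iff, ← hspan k, sup_le_iff, Submodule.span_le]
    constructor
    · intro g hg
      have := hxS ⟨k, g, hg⟩
      rwa [hxs ⟨k, g, hg⟩] at this
    · rintro _ ⟨w, rfl⟩
      obtain ⟨w₁, hw₁, _, ⟨w₂, rfl⟩, rfl⟩ := Submodule.mem_sup.1
        ((hspan (k + 1)).ge (Submodule.mem_top (x := w)))
      rw [map_add, hdd, add_zero]
      refine (Submodule.span_le (p := (Submodule.span F (Set.range fun i => y i k)).comap
        ((X.obj 0).d (k + 1) k).hom)).2 (fun g hg => ?_) hw₁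
      have := hdS ⟨k + 1, g, hg⟩
      rwa [hxs ⟨k + 1, g, hg⟩] at this

end Existence

/-! ### The isometry theorem -/

theorem IsFactored.exists_isTaggedBarcode {F : Type*} [Field F] {X : ParamChain F}
    (hX : IsFactored X) : ∃ A, IsTaggedBarcode X A := by
  obtain ⟨m, deg, J, hdeg, hiso⟩ := hX.exists_iso_sumFunctor
  exact ⟨degreePart deg J, isTaggedBarcode_iff.2 ⟨m, deg, J, hdeg, hiso, rfl⟩⟩

/-- Uniqueness is algebraic stability for the identity, seen as a `0`-interleaving. -/
theorem IsTaggedBarcode.unique {F : Type*} [Field F] {X : ParamChain F}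
    {A B : ℕ → Multiset TaggedInterval} (hA : IsTaggedBarcode X A) (hB : IsTaggedBarcode X B) :
    A = B := by
  obtain ⟨m, deg, J, hdeg, ⟨e⟩, rfl⟩ := isTaggedBarcode_iff.1 hA
  obtain ⟨m', deg', J', hdeg', ⟨e'⟩, rfl⟩ := isTaggedBarcode_iff.1 hB
  obtain ⟨R, hR⟩ := ((interleaved_self X 0).of_iso e e').exists_isFamilyMatching hdeg hdeg'
  exact funext hR.degreePart_eq

theorem IsFactored.existsUnique_isTaggedBarcode {F : Type*} [Field F] {X : ParamChain F}
    (hX : IsFactored X) : ∃! A, IsTaggedBarcode X A := by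
  obtain ⟨A, hA⟩ := hX.exists_isTaggedBarcode
  exact ⟨A, hA, fun B hB => hB.unique hA⟩

theorem IsFactored.isTaggedBarcode_taggedBarcode {F : Type*} [Field F] {X : ParamChain F}
    (hX : IsFactored X) : IsTaggedBarcode X (taggedBarcode X) := by
  have h := hX.exists_isTaggedBarcode
  rw [taggedBarcode, dif_pos h]
  exact h.choose_spec

theorem bottleneckDist_zero_zero : bottleneckDist 0 0 = 0 := by
  classical
  have h0 : IsEmpty (@Multiset.ToType _ (fun a b => Classical.propDecidable (a = b))
      (0 : Multiset TaggedInterval)) :=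
    ⟨fun a => Nat.not_lt_zero _ (a.2.2.trans_eq (Multiset.count_zero _))⟩
  refine le_antisymm (iInf₂_le_of_le ∅ ⟨by simp, by simp⟩ ?_) zero_le
  simp [matchingCost]

theorem exists_degreePart_eq_zero {ι : Type*} [Fintype ι] (deg : ι → ℕ)
    (J : ι → TaggedInterval) : ∃ N, ∀ n, N ≤ n → degreePart deg J n = 0 := by
  refine ⟨Finset.univ.sup deg + 1, fun n hn => ?_⟩
  rw [degreePart, Multiset.map_eq_zero, Finset.val_eq_zero, Finset.filter_eq_empty_iff]
  rintro i - rfl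
  have := Finset.le_sup (f := deg) (Finset.mem_univ i)
  omega

/-- The isometry theorem for given decompositions into interval functors. -/
theorem isGreatest_interleavingDist {F : Type*} [Field F] {X Y : ParamChain F}
    {A B : ℕ → Multiset TaggedInterval} (hA : IsTaggedBarcode X A) (hB : IsTaggedBarcode Y B) :
    IsGreatest (Set.range fun n => bottleneckDist (A n) (B n)) (interleavingDist X Y) := by
  obtain ⟨m, deg, J, hdeg, ⟨e⟩, rfl⟩ := isTaggedBarcode_iff.1 hA
  obtain ⟨m', deg', J', hdeg', ⟨e'⟩, rfl⟩ := isTaggedBarcode_iff.1 hB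
  set f := fun n => bottleneckDist (degreePart deg J n) (degreePart deg' J' n) with hf
  have hle : ∀ n, f n ≤ interleavingDist X Y := by
    intro n
    refine le_iInf₂ fun ε _ => le_iInf fun h => ?_
    obtain ⟨R, hR⟩ := (h.of_iso e e').exists_isFamilyMatching hdeg hdeg'
    exact hR.bottleneckDist_le n
  obtain ⟨N, hN⟩ := exists_degreePart_eq_zero deg J
  obtain ⟨N', hN'⟩ := exists_degreePart_eq_zero deg' J'
  obtain ⟨n₀, -, hmax⟩ := (Finset.range (N + N' + 1)).exists_max_image f ⟨0, by simp⟩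
  have hmax' : ∀ n, f n ≤ f n₀ := by
    intro n
    by_cases hn : n < N + N' + 1
    · exact hmax n (Finset.mem_range.2 hn)
    · rw [hf]
      simp only
      rw [hN n (by omega), hN' n (by omega), bottleneckDist_zero_zero]
      exact zero_le
  refine ⟨⟨n₀, le_antisymm (hle n₀) (le_of_forall_gt fun c hc => ?_)⟩, ?_⟩
  · obtain ⟨ε, hε, hεc⟩ := ENNReal.lt_iff_exists_nnreal_btwn.1 hc
    obtain ⟨R, hR⟩ := exists_isFamilyMatching_of_bottleneckDist_lt
      fun n => (hmax' n).trans_lt hε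
    refine lt_of_le_of_lt (iInf₂_le_of_le ε (ENNReal.coe_pos.1 (zero_le.trans_lt hε)) ?_) hεc
    exact iInf_le _ (hR.interleaved.of_iso e.symm e'.symm)
  · rintro _ ⟨n, rfl⟩
    exact hle n

end FactoredChain

theorem mainTheorem2 {F : Type*} [Field F] (X Y : FactoredChain.ParamChain F)
    (hX : FactoredChain.IsFactored X) (hY : FactoredChain.IsFactored Y) :
    (∃! A : ℕ → Multiset FactoredChain.TaggedInterval, FactoredChain.IsTaggedBarcode X A) ∧
    (∃! B : ℕ → Multiset FactoredChain.TaggedInterval, FactoredChain.IsTaggedBarcode Y B) ∧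
    IsGreatest
      (Set.range fun n : ℕ => FactoredChain.bottleneckDist
        (FactoredChain.taggedBarcode X n) (FactoredChain.taggedBarcode Y n))
      (FactoredChain.interleavingDist X Y) :=
  ⟨hX.existsUnique_isTaggedBarcode, hY.existsUnique_isTaggedBarcode,
    FactoredChain.isGreatest_interleavingDist hX.isTaggedBarcode_taggedBarcode
      hY.isTaggedBarcode_taggedBarcode⟩
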